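/- All spaces are $T_0$; $\mathbb R_+=[0,\infty)$ and $\overline{\mathbb R}_+=[0,\infty]$ carry their Scott topologies. A $\mathtt K$-category $\mathcal K$ is a full subcategory of the category $\mathbf{TOP}_0$ of $T_0$ spaces and continuous maps that is closed under homeomorphism, contains all sober spaces, is such that in a sober space every intersection of subspaces belonging to $\mathcal K$ ($\mathcal K$-subspaces) is a $\mathcal K$-subspace, and is such that the preimage of a $\mathcal K$-subspace under a continuous map between sober spaces is a $\mathcal K$-subspace. Its objects are called $\mathcal K$-spaces. For a space $X$ let $\mathcal V_wX$ be the set of continuous valuations on $X$ (strict, monotone, modular and Scott-continuous maps $\mu$ from the lattice of open sets of $X$ to $\overline{\mathbb R}_+$) with the weak topology, generated by the sets $[U>r]=\{\mu\mid\mu(U)>r\}$ with $U\subseteq X$ open and $r\in\mathbb R_+$, and with the pointwise cone operations. A simple valuation is a finite sum $\sum_{i=1}^n r_i\delta_{x_i}$ with $r_i\in\mathbb R_+$, $x_i\in X$, where $\delta_x(U)=1$ if $x\in U$ and $\delta_x(U)=0$ otherwise. Let $\mathcal V_{\mathrm s}X\subseteq\mathcal V_wX$ be the subspace of simple valuations and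 $\mathcal V_{\mathcal K}X$ the smallest $\mathcal K$-subspace of $\mathcal V_wX$ that contains $\mathcal V_{\mathrm s}X$. $\mathcal V_{\mathcal K}$ is a monad on $\mathbf{TOP}_0$ with $\mathcal V_{\mathcal K}f(\mu)(U)=\mu(f^{-1}(U))$, unit $x\mapsto\delta_x$ and multiplication $\varpi\mapsto\bigl(U\mapsto\int\mu(U)\,d\varpi(\mu)\bigr)$, where $\int h\,d\mu=\int_0^\infty\mu(h^{-1}(r,\infty])\,dr$ for lower semicontinuous $h$. A cone is a commutative monoid with a scalar multiplication by $\mathbb R_+$ that satisfies the vector space axioms (including $0\cdot x=0$ and $r\cdot 0=0$). A topological cone is a cone with a $T_0$ topology such that addition and scalar multiplication $\mathbb R_+\times C\to C$ are jointly continuous. It is weakly locally convex if every open neighbourhood of a point $x$ contains a convex, not necessarily open, neighbourhood of $x$. A $\mathcal K$-cone is a topological cone that is a $\mathcal K$-space. A barycentre of a continuous valuation $\nu$ on a topological cone $C$ is a point $b\in C$ with $\Lambda(b)=\int\Lambda\,d\nu$ for every lower semicontinuous linear map $\Lambda\colon C\to\overline{\mathbb R}_+$. **Theorem.** Let $\mathcal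 K$ be a $\mathtt K$-category. Then for every $T_0$ space $X$ the inclusion $\mathcal V_{\mathrm s}X\to\mathcal V_{\mathcal K}X$ is a $\mathcal K$-completion: $\mathcal V_{\mathcal K}X$ is a $\mathcal K$-space, the inclusion is a topological embedding, and every continuous map from $\mathcal V_{\mathrm s}X$ to a $\mathcal K$-space extends uniquely to a continuous map on $\mathcal V_{\mathcal K}X$. Moreover, the Eilenberg–Moore category $\mathbf{TOP}_0^{\mathcal V_{\mathcal K}}$ is isomorphic to the category of weakly locally convex $\mathcal K$-cones and continuous linear maps, by mutually inverse functors that preserve underlying spaces and underlying maps and act on objects as follows. 1. If $(X,\rho)$ is a $\mathcal V_{\mathcal K}$-algebra, then the corresponding weakly locally convex $\mathcal K$-cone is $X$ with $x+y=\rho(\delta_x+\delta_y)$ and $r\cdot x=\rho(r\delta_x)$. With respect to this cone structure $\rho$ is linear and maps each $\mu\in\mathcal V_{\mathcal K}X$ to one of its barycentres, and $\rho\bigl(\sum_i r_i\delta_{x_i}\bigr)=\sum_i r_ix_i$. 2. If $C$ is a weakly locally convex $\mathcal K$-cone, then the corresponding algebra is $(C,\rho_C)$, where $\rho_C\colon\mathcal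 V_{\mathcal K}C\to C$ is continuous and linear, maps each $\mu\in\mathcal V_{\mathcal K}C$ to one of its barycentres, and satisfies $\rho_C\bigl(\sum_i r_i\delta_{x_i}\bigr)=\sum_i r_ix_i$ for every simple valuation. It is the only continuous map $\mathcal V_{\mathcal K}C\to C$ with this last property. -/

import Mathlib

open CategoryTheory TopologicalSpace Set Filter Topology
open scoped NNReal ENNReal

universe u

namespace ValuationCones

/-- A continuous valuation on a topological space. -/
structure ContValuation (X : Type*) [TopologicalSpace X] where
  toFun : Opens X → ℝ≥0∞
  map_bot' : toFun ⊥ = 0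
  mono' : Monotone toFun
  modular' : ∀ U V : Opens X, toFun U + toFun V = toFun (U ⊔ V) + toFun (U ⊓ V)
  scott' : ∀ D : Set (Opens X), D.Nonempty → DirectedOn (· ≤ ·) D →
    toFun (sSup D) = ⨆ U ∈ D, toFun U

namespace ContValuation

section Basic

variable {X : Type*} [TopologicalSpace X]

instance : CoeFun (ContValuation X) (fun _ => Opens X → ℝ≥0∞) := ⟨toFun⟩

theorem ext {μ ν : ContValuation X} (h : ∀ U, μ U = ν U) : μ = ν := by
  cases μ; cases ν; congr; exact funext h

theorem map_iSup (μ : ContValuation X) {ι : Type*} [Nonempty ι] (V : ι → Opens X)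
    (hV : Directed (· ≤ ·) V) : μ (⨆ i, V i) = ⨆ i, μ (V i) := by
  have := μ.scott' (Set.range V) (Set.range_nonempty V) hV.directedOn_range
  rwa [sSup_range, iSup_range] at this

theorem biSup_add_biSup {D : Set (Opens X)} (hD : D.Nonempty) (hd : DirectedOn (· ≤ ·) D)
    {f g : Opens X → ℝ≥0∞} (hf : Monotone f) (hg : Monotone g) :
    (⨆ U ∈ D, f U) + (⨆ U ∈ D, g U) = ⨆ U ∈ D, (f U + g U) := by
  have : Nonempty D := hD.to_subtype
  simp only [iSup_subtype']
  refine ENNReal.iSup_add_iSup fun i j => ?_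
  obtain ⟨k, hk, hik, hjk⟩ := hd i i.2 j j.2
  exact ⟨⟨k, hk⟩, add_le_add (hf hik) (hg hjk)⟩

instance : Zero (ContValuation X) :=
  ⟨{  toFun := fun _ => 0
      map_bot' := rfl
      mono' := fun _ _ _ => le_rfl
      modular' := fun _ _ => rfl
      scott' := fun D _ _ => by simp }⟩

instance : Add (ContValuation X) :=
  ⟨fun μ ν =>
    { toFun := fun U => μ U + ν U
      map_bot' := by simp [μ.map_bot', ν.map_bot']
      mono' := fun _ _ h => add_le_add (μ.mono' h) (ν.mono' h)
      modular' := fun U V => by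
        rw [add_add_add_comm, μ.modular', ν.modular', add_add_add_comm]
      scott' := fun D hD hd => by
        rw [μ.scott' D hD hd, ν.scott' D hD hd, biSup_add_biSup hD hd μ.mono' ν.mono'] }⟩

noncomputable instance : SMul ℝ≥0 (ContValuation X) :=
  ⟨fun r μ =>
    { toFun := fun U => (r : ℝ≥0∞) * μ U
      map_bot' := by simp [μ.map_bot']
      mono' := fun _ _ h => mul_le_mul_right (μ.mono' h) _
      modular' := fun U V => by rw [← mul_add, μ.modular', mul_add]
      scott' := fun D hD hd => by
        rw [μ.scott' D hD hd]; simp only [ENNReal.mul_iSup] }⟩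

@[simp] theorem zero_apply (U : Opens X) : (0 : ContValuation X) U = 0 := rfl

@[simp] theorem add_apply (μ ν : ContValuation X) (U : Opens X) : (μ + ν) U = μ U + ν U := rfl

@[simp] theorem smul_apply (r : ℝ≥0) (μ : ContValuation X) (U : Opens X) :
    (r • μ) U = (r : ℝ≥0∞) * μ U := rfl

/-- Pointwise addition and the zero valuation. -/
instance : AddCommMonoid (ContValuation X) where
  add_assoc μ ν κ := ext fun U => add_assoc _ _ _
  zero_add μ := ext fun U => zero_add _
  add_zero μ := ext fun U => add_zero _
  add_comm μ ν := ext fun U => add_comm _ _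
  nsmul := nsmulRec

/-- The cone structure on continuous valuations. -/
noncomputable instance : Module ℝ≥0 (ContValuation X) where
  one_smul μ := ext fun U => by simp
  mul_smul r s μ := ext fun U => by simp [mul_assoc]
  smul_zero r := ext fun U => by simp
  smul_add r μ ν := ext fun U => by simp [mul_add]
  add_smul r s μ := ext fun U => by simp [add_mul]
  zero_smul μ := ext fun U => by simp

open Classical in
/-- The Dirac mass at `x`. -/
noncomputable def dirac (x : X) : ContValuation X where
  toFun U := if x ∈ U then 1 else 0
  map_bot' := if_neg id
  mono' U V h := by
    by_cases hx : x ∈ U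
    · simp [hx, h hx]
    · simp [hx]
  modular' U V := by
    by_cases h1 : x ∈ U <;> by_cases h2 : x ∈ V <;> simp [h1, h2]
  scott' D hD hd := by
    by_cases hx : ∃ U ∈ D, x ∈ U
    · obtain ⟨U, hU, hxU⟩ := hx
      rw [if_pos (Opens.mem_sSup.2 ⟨U, hU, hxU⟩)]
      refine le_antisymm ?_ (iSup₂_le fun V _ => by split_ifs <;> simp)
      refine le_trans ?_ (le_iSup₂ U hU)
      simp [hxU]
    · rw [if_neg (fun h => hx (Opens.mem_sSup.1 h))]
      symm
      simp only [ENNReal.iSup_eq_zero]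
      intro U hU
      exact if_neg fun h => hx ⟨U, hU, h⟩

open Classical in
theorem dirac_apply (x : X) (U : Opens X) : dirac x U = if x ∈ U then 1 else 0 := rfl

/-- Simple valuations: finite linear combinations `∑ rᵢ δ_{xᵢ}` with `rᵢ ∈ ℝ₊`. -/
def IsSimple (μ : ContValuation X) : Prop :=
  ∃ (n : ℕ) (r : Fin n → ℝ≥0) (x : Fin n → X), μ = ∑ i, r i • dirac (x i)

/-- The weak topology, generated by the sets `[U > r]`. -/
instance : TopologicalSpace (ContValuation X) :=
  generateFrom {s | ∃ (U : Opens X) (r : ℝ≥0), s = {μ | (r : ℝ≥0∞) < μ U}}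

/-- The push-forward `μ ∘ f⁻¹`. -/
def map {Y : Type*} [TopologicalSpace Y] (f : C(X, Y)) (μ : ContValuation X) :
    ContValuation Y where
  toFun V := μ (Opens.comap f V)
  map_bot' := by simpa using μ.map_bot'
  mono' _ _ h := μ.mono' (Opens.comap_mono f h)
  modular' U V := by simpa using μ.modular' (Opens.comap f U) (Opens.comap f V)
  scott' D hD hd := by
    have : Nonempty D := hD.to_subtype
    rw [sSup_eq_iSup', _root_.map_iSup (Opens.comap f), μ.map_iSup, iSup_subtype']
    intro U V
    obtain ⟨W, hW, h1, h2⟩ := hd U U.2 V V.2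
    exact ⟨⟨W, hW⟩, Opens.comap_mono f h1, Opens.comap_mono f h2⟩

end Basic

section Riemann

/-- The dyadic Riemann sums of order `n` as an integral of a step function. -/
theorem lintegral_dyadic (F : ℝ → ℝ≥0∞) (n : ℕ) :
    ∫⁻ r in Ioi (0 : ℝ), F ((⌊(2 : ℝ) ^ n * r⌋₊ + 1 : ℝ) / 2 ^ n) =
      ∑' k : ℕ, ENNReal.ofReal (1 / 2 ^ n) * F ((k + 1 : ℝ) / 2 ^ n) := by
  have h2 : (0 : ℝ) < 2 ^ n := by positivity
  rw [MeasureTheory.setLIntegral_congr (MeasureTheory.Ioi_ae_eq_Ici (a := (0 : ℝ)))]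
  have hU : Ici (0 : ℝ) = ⋃ k : ℕ, Ico ((k : ℝ) / 2 ^ n) ((k + 1 : ℝ) / 2 ^ n) := by
    ext r
    simp only [mem_Ici, mem_iUnion, mem_Ico]
    constructor
    · intro hr
      refine ⟨⌊(2 : ℝ) ^ n * r⌋₊, ?_, ?_⟩
      · rw [div_le_iff₀ h2, mul_comm]
        exact Nat.floor_le (by positivity)
      · rw [lt_div_iff₀ h2, mul_comm]
        exact Nat.lt_floor_add_one _
    · rintro ⟨k, hk, -⟩
      exact le_trans (by positivity) hk
  have hd : Pairwise (Function.onFun Disjoint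
      fun k : ℕ => Ico ((k : ℝ) / 2 ^ n) ((k + 1 : ℝ) / 2 ^ n)) := by
    have hm : Monotone fun k : ℕ => (k : ℝ) / 2 ^ n := fun a b hab => by
      dsimp only; gcongr
    have := hm.pairwise_disjoint_on_Ico_succ
    simpa using this
  rw [hU, MeasureTheory.lintegral_iUnion (fun _ => measurableSet_Ico) hd]
  refine tsum_congr fun k => ?_
  have : ∀ r ∈ Ico ((k : ℝ) / 2 ^ n) ((k + 1 : ℝ) / 2 ^ n),
      F ((⌊(2 : ℝ) ^ n * r⌋₊ + 1 : ℝ) / 2 ^ n) = F ((k + 1 : ℝ) / 2 ^ n) := by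
    rintro r ⟨h1, h2'⟩
    rw [div_le_iff₀ h2] at h1
    rw [lt_div_iff₀ h2] at h2'
    have : ⌊(2 : ℝ) ^ n * r⌋₊ = k := by
      rw [Nat.floor_eq_iff (le_trans (by positivity) (h1.trans_eq (mul_comm _ _)))]
      rw [mul_comm]; exact ⟨h1, h2'⟩
    rw [this]
  rw [MeasureTheory.setLIntegral_congr_fun measurableSet_Ico this,
    MeasureTheory.setLIntegral_const, Real.volume_Ico, mul_comm]
  congr 2
  ring

theorem dyadic_antitone (r : ℝ) (hr : 0 < r) :
    Antitone fun n : ℕ => (⌊(2 : ℝ) ^ n * r⌋₊ + 1 : ℝ) / 2 ^ n := by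
  refine antitone_nat_of_succ_le fun n => ?_
  have h2 : (0 : ℝ) < 2 ^ n := by positivity
  rw [pow_succ, div_le_div_iff₀ (by positivity) h2]
  have h : ⌊(2 : ℝ) ^ n * 2 * r⌋₊ < 2 * (⌊(2 : ℝ) ^ n * r⌋₊ + 1) := by
    rw [Nat.floor_lt (by positivity)]
    have := Nat.lt_floor_add_one ((2 : ℝ) ^ n * r)
    push_cast
    linarith
  have h' : (⌊(2 : ℝ) ^ n * 2 * r⌋₊ + 1 : ℝ) ≤ 2 * (⌊(2 : ℝ) ^ n * r⌋₊ + 1) := by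
    exact_mod_cast h
  nlinarith

theorem dyadic_sums_monotone {F : ℝ → ℝ≥0∞} (hF : Antitone F) :
    Monotone fun n : ℕ => ∑' k : ℕ, ENNReal.ofReal (1 / 2 ^ n) * F ((k + 1 : ℝ) / 2 ^ n) := by
  intro m n hmn
  simp only [← lintegral_dyadic]
  refine MeasureTheory.setLIntegral_mono' measurableSet_Ioi fun r hr => ?_
  exact hF (dyadic_antitone r hr hmn)

theorem lintegral_eq_iSup_dyadic {F : ℝ → ℝ≥0∞} (hF : Antitone F)
    (hc : ∀ r, F r ≤ ⨆ s : Ioi r, F s) :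
    ∫⁻ r in Ioi (0 : ℝ), F r =
      ⨆ n : ℕ, ∑' k : ℕ, ENNReal.ofReal (1 / 2 ^ n) * F ((k + 1 : ℝ) / 2 ^ n) := by
  simp only [← lintegral_dyadic]
  rw [← MeasureTheory.lintegral_iSup']
  · refine MeasureTheory.setLIntegral_congr_fun measurableSet_Ioi fun r hr => ?_
    have hr : 0 < r := hr
    refine le_antisymm ((hc r).trans (iSup_le fun s => ?_)) (iSup_le fun n => hF ?_)
    · obtain ⟨s, hs⟩ := s
      have hs : r < s := hs
      obtain ⟨n, hn⟩ := exists_pow_lt_of_lt_one (sub_pos.2 hs) (by norm_num : (1 / 2 : ℝ) < 1)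
      refine le_trans (hF ?_) (le_iSup (fun n : ℕ => F ((⌊(2 : ℝ) ^ n * r⌋₊ + 1 : ℝ) / 2 ^ n)) n)
      have h2 : (0 : ℝ) < 2 ^ n := by positivity
      rw [one_div, inv_pow] at hn
      have h3 := Nat.floor_le (show 0 ≤ (2 : ℝ) ^ n * r by positivity)
      have h4 : 1 < (s - r) * 2 ^ n := by
        have := mul_lt_mul_of_pos_right hn h2
        rwa [inv_mul_cancel₀ h2.ne'] at this
      rw [div_le_iff₀ h2]
      nlinarith
    · have h2 : (0 : ℝ) < 2 ^ n := by positivity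
      rw [le_div_iff₀ h2, mul_comm]
      exact (Nat.lt_floor_add_one _).le
  · intro n
    refine (hF.measurable.comp ?_).aemeasurable
    refine Measurable.div_const (Measurable.add_const ?_ _) _
    exact measurable_from_nat.comp (Nat.measurable_floor.comp (measurable_const_mul _))
  · refine (MeasureTheory.ae_restrict_iff' measurableSet_Ioi).2 (Eventually.of_forall ?_)
    intro r hr m n hmn
    exact hF (dyadic_antitone r hr hmn)

end Riemann

section Integral

variable {X : Type*} [TopologicalSpace X]

/-- The open set `h⁻¹(r, ∞]`. -/
def superlevel (h : X → ℝ≥0∞) (hh : LowerSemicontinuous h) (r : ℝ≥0∞) : Opens X :=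
  ⟨{x | r < h x}, hh.isOpen_preimage r⟩

theorem mem_superlevel {h : X → ℝ≥0∞} (hh : LowerSemicontinuous h) {r : ℝ≥0∞} {x : X} :
    x ∈ superlevel h hh r ↔ r < h x := Iff.rfl

/-- The Choquet-type integral `∫ h dμ = ∫₀^∞ μ(h⁻¹(r, ∞]) dr`. -/
noncomputable def integral (μ : ContValuation X) (h : X → ℝ≥0∞) (hh : LowerSemicontinuous h) :
    ℝ≥0∞ :=
  ∫⁻ r : ℝ in Ioi (0 : ℝ), μ (superlevel h hh (ENNReal.ofReal r))

theorem superlevel_anti {h : X → ℝ≥0∞} (hh : LowerSemicontinuous h) :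
    Antitone (superlevel h hh) := fun _ _ hrs _ hx => lt_of_le_of_lt hrs hx

theorem antitone_superlevel (μ : ContValuation X) {h : X → ℝ≥0∞} (hh : LowerSemicontinuous h) :
    Antitone fun r : ℝ => μ (superlevel h hh (ENNReal.ofReal r)) := fun _ _ hrs =>
  μ.mono' (superlevel_anti hh (ENNReal.ofReal_le_ofReal hrs))

theorem superlevel_right (μ : ContValuation X) {h : X → ℝ≥0∞} (hh : LowerSemicontinuous h)
    (r : ℝ) : μ (superlevel h hh (ENNReal.ofReal r)) ≤
      ⨆ s : Ioi r, μ (superlevel h hh (ENNReal.ofReal s)) := by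
  rw [← μ.map_iSup]
  · refine μ.mono' fun x hx => ?_
    have hx : ENNReal.ofReal r < h x := hx
    obtain ⟨q, hq1, hq2⟩ := ENNReal.lt_iff_exists_nnreal_btwn.1 hx
    refine Opens.mem_iSup.2 ⟨⟨q, ?_⟩, ?_⟩
    · by_contra hle
      have hle : (q : ℝ) ≤ r := not_lt.1 hle
      have := ENNReal.ofReal_le_ofReal hle
      rw [ENNReal.ofReal_coe_nnreal] at this
      exact absurd hq1 this.not_gt
    · change ENNReal.ofReal (q : ℝ) < h x
      rwa [ENNReal.ofReal_coe_nnreal]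
  · refine directed_of_isDirected_ge fun a b hab => ?_
    exact superlevel_anti hh (ENNReal.ofReal_le_ofReal hab)

theorem integral_eq (μ : ContValuation X) {h : X → ℝ≥0∞} (hh : LowerSemicontinuous h) :
    μ.integral h hh = ⨆ n : ℕ, ∑' k : ℕ, ENNReal.ofReal (1 / 2 ^ n) *
      μ (superlevel h hh (ENNReal.ofReal ((k + 1 : ℝ) / 2 ^ n))) :=
  lintegral_eq_iSup_dyadic (antitone_superlevel μ hh) (superlevel_right μ hh)

theorem integral_congr (μ : ContValuation X) {h g : X → ℝ≥0∞} (e : ∀ x, h x = g x)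
    (hh : LowerSemicontinuous h) (hg : LowerSemicontinuous g) :
    μ.integral h hh = μ.integral g hg := by
  obtain rfl : h = g := funext e
  rfl

theorem integral_mono (μ : ContValuation X) {h g : X → ℝ≥0∞} (e : ∀ x, h x ≤ g x)
    (hh : LowerSemicontinuous h) (hg : LowerSemicontinuous g) :
    μ.integral h hh ≤ μ.integral g hg :=
  MeasureTheory.lintegral_mono fun _ => μ.mono' fun x hx => lt_of_lt_of_le hx (e x)

theorem integral_iSup (μ : ContValuation X) {ι : Type*} [Nonempty ι] {h : ι → X → ℝ≥0∞}
    {g : X → ℝ≥0∞} (hd : Directed (· ≤ ·) h) (e : ∀ x, g x = ⨆ i, h i x)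
    (hh : ∀ i, LowerSemicontinuous (h i)) (hg : LowerSemicontinuous g) :
    μ.integral g hg = ⨆ i, μ.integral (h i) (hh i) := by
  have key : ∀ r, μ (superlevel g hg r) = ⨆ i, μ (superlevel (h i) (hh i) r) := by
    intro r
    rw [← μ.map_iSup]
    · congr 1
      ext x
      simp only [SetLike.mem_coe, mem_superlevel, e, lt_iSup_iff, Opens.mem_iSup]
    · intro i j
      obtain ⟨k, hk1, hk2⟩ := hd i j
      exact ⟨k, fun x hx => lt_of_lt_of_le hx (hk1 x), fun x hx => lt_of_lt_of_le hx (hk2 x)⟩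
  simp only [integral_eq, key, ENNReal.tsum_eq_iSup_nat, ENNReal.mul_iSup]
  rw [iSup_comm (ι := ι)]
  refine iSup_congr fun n => ?_
  rw [iSup_comm (ι := ι)]
  refine iSup_congr fun m => ?_
  refine ENNReal.finsetSum_iSup fun i j => ?_
  obtain ⟨k, hk1, hk2⟩ := hd i j
  refine ⟨k, fun a => ⟨?_, ?_⟩⟩
  · exact mul_le_mul_right (μ.mono' fun x hx => lt_of_lt_of_le hx (hk1 x)) _
  · exact mul_le_mul_right (μ.mono' fun x hx => lt_of_lt_of_le hx (hk2 x)) _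

/-- A step function `c · χ_U` is lower semicontinuous. -/
theorem lsc_step (c : ℝ≥0∞) (U : Opens X) :
    LowerSemicontinuous ((U : Set X).indicator fun _ => c) :=
  U.isOpen.lowerSemicontinuous_indicator (zero_le)

theorem integral_dirac (x : X) {h : X → ℝ≥0∞} (hh : LowerSemicontinuous h) :
    (dirac x).integral h hh = h x := by
  have e : ∀ r : ℝ, dirac x (superlevel h hh (ENNReal.ofReal r)) =
      {r : ℝ | ENNReal.ofReal r < h x}.indicator 1 r := by
    intro r
    simp only [dirac_apply, mem_superlevel, indicator, mem_ofPred_eq, Pi.one_apply]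
  have hm : MeasurableSet {r : ℝ | ENNReal.ofReal r < h x} :=
    measurableSet_lt ENNReal.measurable_ofReal measurable_const
  rw [integral]
  simp only [e]
  rw [MeasureTheory.lintegral_indicator_one hm, MeasureTheory.Measure.restrict_apply hm]
  by_cases ht : h x = ∞
  · simp [ht]
  · have : {r : ℝ | ENNReal.ofReal r < h x} ∩ Ioi 0 = Ioo 0 (h x).toReal := by
      ext r
      simp only [mem_inter_iff, mem_ofPred_eq, mem_Ioi, mem_Ioo]
      constructor
      · rintro ⟨h1, h2⟩
        exact ⟨h2, (ENNReal.ofReal_lt_iff_lt_toReal h2.le ht).1 h1⟩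
      · rintro ⟨h1, h2⟩
        exact ⟨(ENNReal.ofReal_lt_iff_lt_toReal h1.le ht).2 h2, h1⟩
    rw [this, Real.volume_Ioo, sub_zero, ENNReal.ofReal_toReal ht]

theorem integral_zero_val {h : X → ℝ≥0∞} (hh : LowerSemicontinuous h) :
    (0 : ContValuation X).integral h hh = 0 := by
  simp [integral]

theorem integral_add_val (μ ν : ContValuation X) {h : X → ℝ≥0∞} (hh : LowerSemicontinuous h) :
    (μ + ν).integral h hh = μ.integral h hh + ν.integral h hh :=
  MeasureTheory.lintegral_add_left (antitone_superlevel μ hh).measurable _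

theorem integral_smul_val (r : ℝ≥0) (μ : ContValuation X) {h : X → ℝ≥0∞}
    (hh : LowerSemicontinuous h) : (r • μ).integral h hh = r * μ.integral h hh :=
  MeasureTheory.lintegral_const_mul _ (antitone_superlevel μ hh).measurable

theorem integral_map {Y : Type*} [TopologicalSpace Y] (f : C(X, Y)) (μ : ContValuation X)
    {h : Y → ℝ≥0∞} (hh : LowerSemicontinuous h) (hf : LowerSemicontinuous fun x => h (f x)) :
    (map f μ).integral h hh = μ.integral (fun x => h (f x)) hf := rfl

theorem integral_zero (μ : ContValuation X)
    (h0 : LowerSemicontinuous fun _ : X => (0 : ℝ≥0∞)) : μ.integral _ h0 = 0 := by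
  have : ∀ r, superlevel (fun _ : X => (0 : ℝ≥0∞)) h0 r = ⊥ := fun r => by
    ext x; simp [superlevel]
  simp [integral, this, μ.map_bot']

end Integral

section Additivity

variable {X : Type*} [TopologicalSpace X]

theorem lsc_const_mul (c : ℝ≥0) {h : X → ℝ≥0∞} (hh : LowerSemicontinuous h) :
    LowerSemicontinuous fun x => (c : ℝ≥0∞) * h x :=
  (ENNReal.continuous_const_mul ENNReal.coe_ne_top).comp_lowerSemicontinuous hh
    fun _ _ hab => mul_le_mul_right hab _

theorem lintegral_shift (μ : ContValuation X) {f : X → ℝ≥0∞} (hf : LowerSemicontinuous f)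
    (c : ℝ≥0) (U : Opens X) (hfc : LowerSemicontinuous fun x => f x + c) :
    ∫⁻ r : ℝ in Ioi (0 : ℝ), μ (U ⊓ superlevel (fun x => f x + c) hfc (ENNReal.ofReal r)) =
      c * μ U + ∫⁻ r : ℝ in Ioi (0 : ℝ), μ (U ⊓ superlevel f hf (ENNReal.ofReal r)) := by
  have hm : Measurable fun r : ℝ =>
      μ (U ⊓ superlevel (fun x => f x + c) hfc (ENNReal.ofReal r)) := by
    refine Antitone.measurable fun r s hrs => μ.mono' (inf_le_inf_left U ?_)
    exact superlevel_anti hfc (ENNReal.ofReal_le_ofReal hrs)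
  rw [MeasureTheory.setLIntegral_congr (MeasureTheory.Ioi_ae_eq_Ici (a := (0 : ℝ))),
    ← Ico_union_Ici_eq_Ici (NNReal.coe_nonneg c),
    MeasureTheory.lintegral_union measurableSet_Ici
      ((Iio_disjoint_Ici le_rfl).mono_left Ico_subset_Iio_self)]
  congr 1
  · have : ∀ r ∈ Ico (0 : ℝ) c,
        μ (U ⊓ superlevel (fun x => f x + c) hfc (ENNReal.ofReal r)) = μ U := by
      rintro r ⟨h0, hr⟩
      congr 1
      refine inf_eq_left.2 fun x _ => ?_
      rw [mem_superlevel]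
      refine lt_of_lt_of_le ?_ le_add_self
      rw [← ENNReal.ofReal_coe_nnreal]
      exact (ENNReal.ofReal_lt_ofReal_iff_of_nonneg h0).2 hr
    rw [MeasureTheory.setLIntegral_congr_fun measurableSet_Ico this,
      MeasureTheory.setLIntegral_const, Real.volume_Ico, sub_zero, ENNReal.ofReal_coe_nnreal,
      mul_comm]
  · have hp : (fun r : ℝ => r + (c : ℝ)) ⁻¹' Ici (c : ℝ) = Ici 0 := by
      ext r; simp
    rw [← (MeasureTheory.measurePreserving_add_right MeasureTheory.volume
      (c : ℝ)).setLIntegral_comp_preimage measurableSet_Ici hm, hp]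
    rw [MeasureTheory.setLIntegral_congr (MeasureTheory.Ioi_ae_eq_Ici (a := (0 : ℝ)))]
    refine MeasureTheory.setLIntegral_congr_fun measurableSet_Ici fun r hr => ?_
    have hr : 0 ≤ r := hr
    congr 2
    ext x
    simp only [SetLike.mem_coe, mem_superlevel]
    rw [ENNReal.ofReal_add hr (NNReal.coe_nonneg c), ENNReal.ofReal_coe_nnreal]
    exact ENNReal.add_lt_add_iff_right ENNReal.coe_ne_top

theorem integral_add_step (μ : ContValuation X) {f g : X → ℝ≥0∞} (hf : LowerSemicontinuous f)
    (hg : LowerSemicontinuous g) (c : ℝ≥0) (U : Opens X)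
    (e : ∀ x, g x = f x + (U : Set X).indicator (fun _ => (c : ℝ≥0∞)) x) :
    μ.integral g hg = μ.integral f hf + c * μ U := by
  have hfc : LowerSemicontinuous fun x => f x + (c : ℝ≥0∞) :=
    hf.add lowerSemicontinuous_const
  have key : ∀ r : ℝ, μ (superlevel g hg (ENNReal.ofReal r)) +
      μ (U ⊓ superlevel f hf (ENNReal.ofReal r)) =
      μ (superlevel f hf (ENNReal.ofReal r)) +
      μ (U ⊓ superlevel (fun x => f x + c) hfc (ENNReal.ofReal r)) := by
    intro r
    conv_rhs => rw [μ.modular']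
    congr 2
    · ext x
      simp only [SetLike.mem_coe, mem_superlevel, Opens.coe_sup, Opens.coe_inf, mem_union,
        mem_inter_iff, e]
      by_cases hx : x ∈ U
      · simp only [indicator, SetLike.mem_coe, hx, if_true, true_and]
        exact ⟨Or.inr, fun h => h.elim (fun h => h.trans_le le_self_add) id⟩
      · simp [indicator, hx]
    · ext x
      simp only [SetLike.mem_coe, mem_superlevel, Opens.coe_inf, mem_inter_iff]
      exact ⟨fun h => ⟨h.2, h.1, h.2.trans_le le_self_add⟩, fun h => ⟨h.2.1, h.1⟩⟩
  have hG : Antitone fun r : ℝ => μ (U ⊓ superlevel f hf (ENNReal.ofReal r)) :=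
    fun r s hrs => μ.mono' (inf_le_inf_left U
      (superlevel_anti hf (ENNReal.ofReal_le_ofReal hrs)))
  have h1 : μ.integral g hg +
      ∫⁻ r : ℝ in Ioi (0 : ℝ), μ (U ⊓ superlevel f hf (ENNReal.ofReal r)) =
      μ.integral f hf + c * μ U +
      ∫⁻ r : ℝ in Ioi (0 : ℝ), μ (U ⊓ superlevel f hf (ENNReal.ofReal r)) := by
    rw [add_assoc, ← lintegral_shift μ hf c U hfc, integral, integral,
      ← MeasureTheory.lintegral_add_left (antitone_superlevel μ hg).measurable,
      ← MeasureTheory.lintegral_add_left (antitone_superlevel μ hf).measurable]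
    exact MeasureTheory.lintegral_congr key
  by_cases ht : ∫⁻ r : ℝ in Ioi (0 : ℝ), μ (U ⊓ superlevel f hf (ENNReal.ofReal r)) = ∞
  · have h2 : μ.integral f hf = ∞ := top_le_iff.1 (ht ▸
      MeasureTheory.lintegral_mono fun r => μ.mono' inf_le_right)
    have h3 : μ.integral g hg = ∞ := top_le_iff.1 (h2 ▸
      integral_mono μ (fun x => by rw [e]; exact le_self_add) hf hg)
    rw [h2, h3, top_add]
  · exact (ENNReal.add_left_inj ht).1 h1

/-- The weights `2⁻ⁿ` of the dyadic sums. -/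
noncomputable def wt (n : ℕ) : ℝ≥0 := Real.toNNReal (1 / 2 ^ n)

/-- The `m`-th partial sum of the dyadic step function of order `n` below `g`. -/
noncomputable def dstep (g : X → ℝ≥0∞) (hg : LowerSemicontinuous g) (n m : ℕ) (x : X) : ℝ≥0∞ :=
  ∑ k ∈ Finset.range m, ((superlevel g hg (ENNReal.ofReal ((k + 1 : ℝ) / 2 ^ n)) : Opens X) :
    Set X).indicator (fun _ => (wt n : ℝ≥0∞)) x

theorem lsc_dstep {g : X → ℝ≥0∞} (hg : LowerSemicontinuous g) (n m : ℕ) :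
    LowerSemicontinuous (dstep g hg n m) :=
  lowerSemicontinuous_sum fun _ _ => lsc_step _ _

theorem integral_add_dstep (μ : ContValuation X) {f g : X → ℝ≥0∞} (hf : LowerSemicontinuous f)
    (hg : LowerSemicontinuous g) (n m : ℕ)
    (h : LowerSemicontinuous fun x => f x + dstep g hg n m x) :
    μ.integral _ h = μ.integral f hf + ∑ k ∈ Finset.range m, (wt n : ℝ≥0∞) *
      μ (superlevel g hg (ENNReal.ofReal ((k + 1 : ℝ) / 2 ^ n))) := by
  induction m with
  | zero => simp [dstep]
  | succ m ih =>
    rw [Finset.sum_range_succ, ← add_assoc, ← ih (hf.add (lsc_dstep hg n m))]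
    refine integral_add_step μ _ _ _ _ fun x => ?_
    rw [dstep, Finset.sum_range_succ, ← add_assoc, dstep]

theorem tsum_dstep {g : X → ℝ≥0∞} (hg : LowerSemicontinuous g) (n : ℕ) (x : X) :
    ⨆ m, dstep g hg n m x = ∑' k : ℕ, ENNReal.ofReal (1 / 2 ^ n) *
      dirac x (superlevel g hg (ENNReal.ofReal ((k + 1 : ℝ) / 2 ^ n))) := by
  rw [ENNReal.tsum_eq_iSup_nat]
  refine iSup_congr fun m => Finset.sum_congr rfl fun k _ => ?_
  rw [dirac_apply, indicator, mul_ite, mul_one, mul_zero]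
  rfl

theorem iSup_dstep {g : X → ℝ≥0∞} (hg : LowerSemicontinuous g) (x : X) :
    g x = ⨆ n, ⨆ m, dstep g hg n m x := by
  rw [← integral_dirac x hg, integral_eq]
  exact iSup_congr fun n => (tsum_dstep hg n x).symm

theorem dstep_mono_m {g : X → ℝ≥0∞} (hg : LowerSemicontinuous g) (n : ℕ) :
    Monotone (dstep g hg n) := fun _ _ hab _ =>
  Finset.sum_le_sum_of_subset (Finset.range_mono hab)

theorem iSup_dstep_mono {g : X → ℝ≥0∞} (hg : LowerSemicontinuous g) :
    Monotone fun n (x : X) => ⨆ m, dstep g hg n m x := by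
  intro a b hab x
  simp only [tsum_dstep]
  exact dyadic_sums_monotone (antitone_superlevel (dirac x) hg) hab

theorem integral_add (μ : ContValuation X) {f g : X → ℝ≥0∞} (hf : LowerSemicontinuous f)
    (hg : LowerSemicontinuous g) (h : LowerSemicontinuous fun x => f x + g x) :
    μ.integral _ h = μ.integral f hf + μ.integral g hg := by
  have l1 : ∀ n, LowerSemicontinuous fun x => f x + ⨆ m, dstep g hg n m x := fun n =>
    hf.add (lowerSemicontinuous_iSup fun m => lsc_dstep hg n m)
  rw [integral_iSup μ (h := fun n x => f x + ⨆ m, dstep g hg n m x)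
    (directed_of_isDirected_le fun a b hab x =>
      add_le_add_right (iSup_dstep_mono hg hab x) _)
    (fun x => by rw [← ENNReal.add_iSup, ← iSup_dstep]) l1 h, integral_eq μ hg,
    ENNReal.add_iSup]
  refine iSup_congr fun n => ?_
  have l2 : ∀ m, LowerSemicontinuous fun x => f x + dstep g hg n m x := fun m =>
    hf.add (lsc_dstep hg n m)
  rw [integral_iSup μ (h := fun m x => f x + dstep g hg n m x)
    (directed_of_isDirected_le fun a b hab x =>
      add_le_add_right (dstep_mono_m hg n hab x) _)
    (fun x => by rw [← ENNReal.add_iSup]) l2 (l1 n), ENNReal.tsum_eq_iSup_nat,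
    ENNReal.add_iSup]
  exact iSup_congr fun m => integral_add_dstep μ hf hg n m (l2 m)

theorem integral_nat_mul (μ : ContValuation X) {f : X → ℝ≥0∞} (hf : LowerSemicontinuous f)
    (N : ℕ) (h : LowerSemicontinuous fun x => (N : ℝ≥0∞) * f x) :
    μ.integral _ h = N * μ.integral f hf := by
  induction N with
  | zero =>
    rw [integral_congr μ (g := fun _ => 0) (fun x => by simp) h lowerSemicontinuous_const,
      Nat.cast_zero, zero_mul]
    exact integral_zero μ _
  | succ N ih =>
    have l := lsc_const_mul (N : ℝ≥0) hf
    have l : LowerSemicontinuous fun x => (N : ℝ≥0∞) * f x := by simpa using l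
    have e : ((N + 1 : ℕ) : ℝ≥0∞) * μ.integral f hf =
        N * μ.integral f hf + μ.integral f hf := by push_cast; ring
    rw [e, ← ih l, ← integral_add μ l hf (l.add hf)]
    exact integral_congr μ (fun x => by push_cast; ring) _ _

theorem integral_wt_mul (μ : ContValuation X) {f : X → ℝ≥0∞} (hf : LowerSemicontinuous f)
    (n : ℕ) (h : LowerSemicontinuous fun x => (wt n : ℝ≥0∞) * f x) :
    μ.integral _ h = wt n * μ.integral f hf := by
  have hw : (wt n : ℝ≥0∞) * ((2 ^ n : ℕ) : ℝ≥0∞) = 1 := by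
    have h2 : (0 : ℝ) < 2 ^ n := by positivity
    have : wt n * ((2 ^ n : ℕ) : ℝ≥0) = 1 := by
      apply NNReal.eq
      rw [NNReal.coe_mul, wt, Real.coe_toNNReal _ (by positivity)]
      push_cast
      field_simp
    exact_mod_cast congrArg ((↑) : ℝ≥0 → ℝ≥0∞) this
  have l := lsc_const_mul ((2 ^ n : ℕ) : ℝ≥0) h
  rw [integral_congr μ (h := f)
    (fun x => by rw [← mul_assoc, mul_comm _ (wt n : ℝ≥0∞), hw, one_mul]) hf
    (show LowerSemicontinuous fun x => ((2 ^ n : ℕ) : ℝ≥0∞) * ((wt n : ℝ≥0∞) * f x) by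
      simpa using l),
    integral_nat_mul μ h, ← mul_assoc, hw, one_mul]

theorem integral_wt_sum (μ : ContValuation X) {f : ℕ → X → ℝ≥0∞}
    (hf : ∀ k, LowerSemicontinuous (f k)) (n m : ℕ)
    (h : LowerSemicontinuous fun x => ∑ k ∈ Finset.range m, (wt n : ℝ≥0∞) * f k x) :
    μ.integral _ h = ∑ k ∈ Finset.range m, (wt n : ℝ≥0∞) * μ.integral (f k) (hf k) := by
  induction m with
  | zero => 
    simp only [Finset.range_zero, Finset.sum_empty]
    exact integral_zero μ _
  | succ m ih =>
    have l : LowerSemicontinuous fun x => ∑ k ∈ Finset.range m, (wt n : ℝ≥0∞) * f k x :=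
      lowerSemicontinuous_sum fun k _ => lsc_const_mul _ (hf k)
    have l' := lsc_const_mul (wt n) (hf m)
    rw [Finset.sum_range_succ, ← ih l, ← integral_wt_mul μ (hf m) n l',
      ← integral_add μ l l' (l.add l')]
    exact integral_congr μ (fun x => by rw [Finset.sum_range_succ]) _ _

end Additivity

section WeakTopology

variable {X Z : Type*} [TopologicalSpace X] [TopologicalSpace Z]

theorem lsc_eval (U : Opens X) : LowerSemicontinuous fun μ : ContValuation X => μ U := by
  intro μ y hy
  obtain ⟨r, hr1, hr2⟩ := ENNReal.lt_iff_exists_nnreal_btwn.1 hy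
  have ho : IsOpen {ν : ContValuation X | (r : ℝ≥0∞) < ν U} :=
    isOpen_generateFrom_of_mem ⟨U, r, rfl⟩
  filter_upwards [ho.mem_nhds hr2] with ν hν
  exact hr1.trans hν

theorem continuous_of_lsc {f : Z → ContValuation X}
    (hf : ∀ U, LowerSemicontinuous fun z => f z U) : Continuous f := by
  refine continuous_generateFrom_iff.2 ?_
  rintro _ ⟨U, r, rfl⟩
  exact (hf U).isOpen_preimage r

theorem le_of_specializes {μ ν : ContValuation X} (h : ν ⤳ μ) (U : Opens X) : μ U ≤ ν U := by
  by_contra hlt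
  rw [not_le] at hlt
  exact lt_irrefl (ν U) (h.mem_open (s := {κ : ContValuation X | ν U < κ U})
    ((lsc_eval U).isOpen_preimage (ν U)) hlt)

theorem specializes_of_le {μ ν : ContValuation X} (h : ∀ U, μ U ≤ ν U) : ν ⤳ μ := by
  rw [Specializes, nhds_generateFrom, nhds_generateFrom]
  refine le_iInf₂ ?_
  rintro _ ⟨h1, U, r, rfl⟩
  exact iInf₂_le _ ⟨lt_of_lt_of_le (show (r : ℝ≥0∞) < μ U from h1) (h U), U, r, rfl⟩

instance : T0Space (ContValuation X) :=
  ⟨fun _ _ h => ext fun U => le_antisymm (le_of_specializes h.specializes' U)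
    (le_of_specializes h.specializes U)⟩

/-- The pointwise supremum of an irreducible set of continuous valuations. -/
noncomputable def supOfIrreducible (A : Set (ContValuation X)) (hA : IsIrreducible A) :
    ContValuation X where
  toFun U := ⨆ μ ∈ A, μ U
  map_bot' := by simp [map_bot']
  mono' U V h := iSup₂_mono fun μ _ => μ.mono' h
  modular' U V := by
    have key : ∀ U V : Opens X,
        (⨆ μ ∈ A, μ U) + (⨆ μ ∈ A, μ V) = ⨆ μ ∈ A, (μ U + μ V) := by
      intro U V
      refine le_antisymm ?_ ?_
      · have : Nonempty A := hA.nonempty.to_subtype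
        rw [iSup_subtype', iSup_subtype', iSup_subtype']
        refine ENNReal.iSup_add_iSup_le fun i j => ?_
        by_contra hlt
        rw [not_le] at hlt
        by_cases hi : i.1 U = 0
        · rw [hi, zero_add] at hlt
          exact absurd ((le_add_self : j.1 V ≤ j.1 U + j.1 V).trans
            (le_iSup (fun k : A => k.1 U + k.1 V) j)) hlt.not_ge
        by_cases hj : j.1 V = 0
        · rw [hj, add_zero] at hlt
          exact absurd ((le_self_add : i.1 U ≤ i.1 U + i.1 V).trans
            (le_iSup (fun k : A => k.1 U + k.1 V) i)) hlt.not_ge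
        obtain ⟨a, ha, b, hb, hab⟩ := ENNReal.exists_lt_add_of_lt_add hlt hi hj
        obtain ⟨κ, hκ, h1, h2⟩ := hA.2 {μ | a < μ U} {μ | b < μ V}
          ((lsc_eval U).isOpen_preimage a) ((lsc_eval V).isOpen_preimage b)
          ⟨i, i.2, ha⟩ ⟨j, j.2, hb⟩
        have h3 : a + b ≤ κ U + κ V := add_le_add (le_of_lt h1) (le_of_lt h2)
        exact absurd (h3.trans (le_iSup (fun k : A => k.1 U + k.1 V) ⟨κ, hκ⟩)) hab.not_ge
      · exact iSup₂_le fun μ hμ => add_le_add (le_iSup₂ (f := fun μ (_ : μ ∈ A) => μ U) μ hμ)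
          (le_iSup₂ (f := fun μ (_ : μ ∈ A) => μ V) μ hμ)
    rw [key, key]
    exact iSup_congr fun μ => iSup_congr fun _ => μ.modular' U V
  scott' D hD hd := by
    simp only [fun μ : ContValuation X => μ.scott' D hD hd]
    exact iSup₂_comm _

instance : QuasiSober (ContValuation X) where
  sober := by
    intro A hA hc
    refine ⟨supOfIrreducible A hA, ?_⟩
    have hmem : supOfIrreducible A hA ∈ A := by
      refine hc.closure_subset ?_
      rw [(isTopologicalBasis_of_subbasis rfl).mem_closure_iff]
      rintro _ ⟨F, ⟨hF, hF'⟩, rfl⟩ hν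
      have := isIrreducible_iff_sInter.1 hA hF.toFinset
        (fun u hu => isOpen_generateFrom_of_mem (hF' (by simpa using hu))) ?_
      · rw [inter_comm]; simpa using this
      · intro u hu
        have hu : u ∈ F := by simpa using hu
        obtain ⟨U, r, rfl⟩ := hF' hu
        have h1 : (r : ℝ≥0∞) < ⨆ μ ∈ A, μ U := hν _ hu
        simp only [lt_iSup_iff] at h1
        obtain ⟨μ, hμ, h2⟩ := h1
        exact ⟨μ, hμ, h2⟩
    refine isGenericPoint_iff_specializes.2 fun ν => ⟨fun h => ?_, fun h => ?_⟩
    · exact h.mem_closed hc hmem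
    · exact specializes_of_le fun U => le_iSup₂ (f := fun μ (_ : μ ∈ A) => μ U) ν h

theorem lsc_integral {h : X → ℝ≥0∞} (hh : LowerSemicontinuous h) :
    LowerSemicontinuous fun μ : ContValuation X => μ.integral h hh := by
  simp only [integral_eq]
  exact lowerSemicontinuous_iSup fun n => lowerSemicontinuous_tsum fun k =>
    lsc_const_mul _ (lsc_eval _)

theorem lsc_comp {f : X → Z} (hf : Continuous f) {h : Z → ℝ≥0∞} (hh : LowerSemicontinuous h) :
    LowerSemicontinuous fun x => h (f x) := hh.comp hf

theorem lsc_eval_comp (g : C(Z, ContValuation X)) (U : Opens X) :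
    LowerSemicontinuous fun z => g z U := lsc_comp g.continuous (lsc_eval U)

/-- The Kleisli extension `g†(ϖ)(U) = ∫ g(z)(U) dϖ(z)` of a continuous map `g : Z → V_w X`. -/
noncomputable def bind (g : C(Z, ContValuation X)) (ϖ : ContValuation Z) : ContValuation X where
  toFun U := ϖ.integral (fun z => g z U) (lsc_eval_comp g U)
  map_bot' := by
    rw [integral_congr ϖ (g := fun _ => 0) (fun z => (g z).map_bot') _ lowerSemicontinuous_const]
    exact integral_zero ϖ _
  mono' U V h := integral_mono ϖ (fun z => (g z).mono' h) _ _
  modular' U V := by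
    rw [← integral_add ϖ _ _ ((lsc_eval_comp g U).add (lsc_eval_comp g V)),
      ← integral_add ϖ _ _ ((lsc_eval_comp g (U ⊔ V)).add (lsc_eval_comp g (U ⊓ V)))]
    exact integral_congr ϖ (fun z => (g z).modular' U V) _ _
  scott' D hD hd := by
    have : Nonempty D := hD.to_subtype
    rw [iSup_subtype']
    refine integral_iSup ϖ (h := fun (U : D) z => g z U) ?_ (fun z => ?_) _ _
    · intro U V
      obtain ⟨W, hW, h1, h2⟩ := hd U U.2 V V.2
      exact ⟨⟨W, hW⟩, fun z => (g z).mono' h1, fun z => (g z).mono' h2⟩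
    · rw [(g z).scott' D hD hd, iSup_subtype']

theorem bind_apply (g : C(Z, ContValuation X)) (ϖ : ContValuation Z) (U : Opens X) :
    bind g ϖ U = ϖ.integral (fun z => g z U) (lsc_eval_comp g U) := rfl

theorem continuous_bind (g : C(Z, ContValuation X)) : Continuous (bind g) :=
  continuous_of_lsc fun _ => lsc_integral _

theorem continuous_map (f : C(Z, X)) : Continuous (map f) :=
  continuous_of_lsc fun _ => lsc_eval _

theorem continuous_dirac : Continuous (dirac : X → ContValuation X) :=
  continuous_of_lsc fun U => by
    have : (fun x : X => dirac x U) = (U : Set X).indicator fun _ => 1 := by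
      funext x; rw [dirac_apply, indicator]; rfl
    rw [this]
    exact lsc_step 1 U

theorem continuous_const_add_val (ν : ContValuation X) : Continuous fun μ => ν + μ :=
  continuous_of_lsc fun U => (lowerSemicontinuous_const (z := ν U)).add (lsc_eval U)

theorem continuous_const_smul_val (r : ℝ≥0) : Continuous fun μ : ContValuation X => r • μ :=
  continuous_of_lsc fun U => lsc_const_mul r (lsc_eval U)

theorem map_dirac (f : C(Z, X)) (z : Z) : map f (dirac z) = dirac (f z) := rfl

theorem map_sum (f : C(Z, X)) {n : ℕ} (r : Fin n → ℝ≥0) (z : Fin n → Z) :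
    map f (∑ i, r i • dirac (z i)) = ∑ i, r i • dirac (f (z i)) := by
  let φ : ContValuation Z →ₗ[ℝ≥0] ContValuation X :=
    { toFun := map f, map_add' := fun _ _ => rfl, map_smul' := fun _ _ => rfl }
  change φ _ = _
  simp only [_root_.map_sum, _root_.map_smul]
  rfl

theorem bind_dirac (g : C(Z, ContValuation X)) (z : Z) : bind g (dirac z) = g z :=
  ext fun U => integral_dirac z (lsc_eval_comp g U)

theorem bind_sum (g : C(Z, ContValuation X)) {n : ℕ} (r : Fin n → ℝ≥0) (z : Fin n → Z) :
    bind g (∑ i, r i • dirac (z i)) = ∑ i, r i • g (z i) := by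
  let φ : ContValuation Z →ₗ[ℝ≥0] ContValuation X :=
    { toFun := bind g
      map_add' := fun _ _ => ext fun _ => integral_add_val _ _ _
      map_smul' := fun _ _ => ext fun _ => integral_smul_val _ _ _ }
  change φ _ = _
  simp only [_root_.map_sum, _root_.map_smul]
  exact Finset.sum_congr rfl fun i _ => congrArg _ (bind_dirac g (z i))

theorem integral_bind (g : C(Z, ContValuation X)) (ϖ : ContValuation Z) {h : X → ℝ≥0∞}
    (hh : LowerSemicontinuous h)
    (hl : LowerSemicontinuous fun z => (g z).integral h hh) :
    (bind g ϖ).integral h hh = ϖ.integral (fun z => (g z).integral h hh) hl := by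
  let V : ℕ → ℕ → Opens X := fun n k => superlevel h hh (ENNReal.ofReal ((k + 1 : ℝ) / 2 ^ n))
  let S : ℕ → ℕ → Z → ℝ≥0∞ := fun n m z =>
    ∑ k ∈ Finset.range m, (wt n : ℝ≥0∞) * g z (V n k)
  have lS : ∀ n m, LowerSemicontinuous (S n m) := fun n m =>
    lowerSemicontinuous_sum fun k _ => lsc_const_mul _ (lsc_eval_comp g _)
  have lT : ∀ n, LowerSemicontinuous fun z => ⨆ m, S n m z := fun n =>
    lowerSemicontinuous_iSup fun m => lS n m
  have eT : ∀ n z, ⨆ m, S n m z =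
      ∑' k : ℕ, ENNReal.ofReal (1 / 2 ^ n) * g z (V n k) := fun n z => by
    rw [ENNReal.tsum_eq_iSup_nat]; rfl
  rw [integral_iSup ϖ (h := fun n z => ⨆ m, S n m z) (directed_of_isDirected_le ?_)
    (fun z => by simp only [eT]; exact integral_eq (g z) hh) lT hl, integral_eq]
  · refine iSup_congr fun n => ?_
    rw [integral_iSup ϖ (h := S n) (directed_of_isDirected_le ?_) (fun z => rfl) (lS n) (lT n),
      ENNReal.tsum_eq_iSup_nat]
    · refine iSup_congr fun m => ?_
      exact (integral_wt_sum ϖ (fun k => lsc_eval_comp g (V n k)) n m (lS n m)).symm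
    · exact fun a b hab z => Finset.sum_le_sum_of_subset (Finset.range_mono hab)
  · intro a b hab z
    simp only [eT]
    exact dyadic_sums_monotone (antitone_superlevel (g z) hh) hab

end WeakTopology

end ContValuation

open ContValuation

/-- A `K`-category, given by its class of objects (the subcategory is full): a class of `T₀` spaces
that is closed under homeomorphism, contains all sober spaces, is closed under intersections of
subspaces of a sober space, and is stable under preimages by continuous maps of sober spaces. -/
structure KCategory where
  IsKSpace : ∀ (X : Type u) [TopologicalSpace X] [T0Space X], Prop
  of_homeomorph : ∀ (X Y : Type u) [TopologicalSpace X] [T0Space X] [TopologicalSpace Y]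
    [T0Space Y], X ≃ₜ Y → IsKSpace X → IsKSpace Y
  of_sober : ∀ (S : Type u) [TopologicalSpace S] [T0Space S] [QuasiSober S], IsKSpace S
  sInter : ∀ (S : Type u) [TopologicalSpace S] [T0Space S] [QuasiSober S] (𝒜 : Set (Set S)),
    (∀ A ∈ 𝒜, IsKSpace A) → IsKSpace ↥(⋂₀ 𝒜)
  preimage : ∀ (S T : Type u) [TopologicalSpace S] [T0Space S] [QuasiSober S]
    [TopologicalSpace T] [T0Space T] [QuasiSober T] (f : S → T), Continuous f →
    ∀ K : Set T, IsKSpace K → IsKSpace ↥(f ⁻¹' K)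

namespace KCategory

variable (𝒦 : KCategory.{u})

section Closure

variable {S T : Type u} [TopologicalSpace S] [T0Space S] [TopologicalSpace T] [T0Space T]

/-- The intersection of all `𝒦`-subspaces containing `A`; in a sober space it is the smallest
`𝒦`-subspace containing `A`. -/
def closure (A : Set S) : Set S := ⋂₀ {B | A ⊆ B ∧ 𝒦.IsKSpace B}

theorem subset_closure (A : Set S) : A ⊆ 𝒦.closure A := subset_sInter fun _ h => h.1

theorem isKSpace_closure [QuasiSober S] (A : Set S) : 𝒦.IsKSpace (𝒦.closure A) :=
  𝒦.sInter S _ fun _ h => h.2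

theorem mapsTo_closure [QuasiSober S] [QuasiSober T] {f : S → T} (hf : Continuous f)
    {A : Set S} {B : Set T} (h : MapsTo f A (𝒦.closure B)) :
    MapsTo f (𝒦.closure A) (𝒦.closure B) := fun _ hx =>
  hx (f ⁻¹' 𝒦.closure B) ⟨h, 𝒦.preimage S T f hf _ (𝒦.isKSpace_closure B)⟩

end Closure

/-- `g : X → Y` is a `𝒦`-completion of `X`. -/
def IsKCompletion {X Y : Type u} [TopologicalSpace X] [TopologicalSpace Y] [T0Space Y]
    (g : X → Y) : Prop :=
  𝒦.IsKSpace Y ∧ IsEmbedding g ∧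
    ∀ (K : Type u) [TopologicalSpace K] [T0Space K], 𝒦.IsKSpace K →
      ∀ f : X → K, Continuous f → ∃! φ : C(Y, K), ∀ x, φ (g x) = f x

section VK

variable (X : Type u) [TopologicalSpace X]

/-- `V_𝒦 X`, the smallest `𝒦`-subspace of `V_w X` that contains all simple valuations, with the
subspace topology and the cone structure of `V_w X`. -/
noncomputable def VK : Submodule ℝ≥0 (ContValuation X) where
  carrier := 𝒦.closure {μ | μ.IsSimple}
  zero_mem' := 𝒦.subset_closure _ ⟨0, Fin.elim0, Fin.elim0, by simp⟩
  add_mem' := by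
    have h1 : ∀ ν : ContValuation X, ν.IsSimple →
        MapsTo (fun μ => ν + μ) (𝒦.closure {μ | μ.IsSimple}) (𝒦.closure {μ | μ.IsSimple}) := by
      rintro ν ⟨n, r, x, rfl⟩
      refine 𝒦.mapsTo_closure (continuous_const_add_val _) ?_
      rintro _ ⟨m, s, y, rfl⟩
      refine 𝒦.subset_closure _ ⟨n + m, Fin.append r s, Fin.append x y, ?_⟩
      simp [Fin.sum_univ_add]
    intro μ ν hμ hν
    refine 𝒦.mapsTo_closure (continuous_const_add_val μ) (fun κ hκ => ?_) hν
    change μ + κ ∈ _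
    rw [add_comm]
    exact h1 κ hκ hμ
  smul_mem' := by
    intro r μ hμ
    refine 𝒦.mapsTo_closure (continuous_const_smul_val r) ?_ hμ
    rintro _ ⟨m, s, y, rfl⟩
    refine 𝒦.subset_closure _ ⟨m, fun i => r * s i, y, ?_⟩
    simp [Finset.smul_sum, mul_smul]

variable {X} {Y : Type u} [TopologicalSpace Y]

theorem isSimple_dirac (x : X) : (dirac x).IsSimple :=
  ⟨1, fun _ => 1, fun _ => x, by simp⟩

theorem mem_VK_of_isSimple {μ : ContValuation X} (h : μ.IsSimple) : μ ∈ 𝒦.VK X :=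
  𝒦.subset_closure _ h

/-- The Dirac mass as an element of `V_𝒦 X`. -/
noncomputable def δ (x : X) : 𝒦.VK X := ⟨dirac x, 𝒦.mem_VK_of_isSimple (isSimple_dirac x)⟩

/-- The inclusion of the space `V_s X` of simple valuations in `V_𝒦 X`. -/
def simpleIncl (μ : {μ : ContValuation X // μ.IsSimple}) : 𝒦.VK X :=
  ⟨μ.1, 𝒦.mem_VK_of_isSimple μ.2⟩

/-- The unit `x ↦ δ_x`. -/
noncomputable def unit : C(X, 𝒦.VK X) := ⟨𝒦.δ, continuous_dirac.subtype_mk _⟩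

theorem map_mem (f : C(X, Y)) {μ : ContValuation X} (hμ : μ ∈ 𝒦.VK X) :
    map f μ ∈ 𝒦.VK Y := by
  refine 𝒦.mapsTo_closure (continuous_map f) ?_ hμ
  rintro _ ⟨m, s, y, rfl⟩
  exact 𝒦.subset_closure _ ⟨m, s, fun i => f (y i), map_sum f s y⟩

/-- The action on maps, `V_𝒦 f (μ) = μ ∘ f⁻¹`. -/
def mapVK (f : C(X, Y)) : C(𝒦.VK X, 𝒦.VK Y) :=
  ⟨fun μ => ⟨map f μ.1, 𝒦.map_mem f μ.2⟩,
    ((continuous_map f).comp continuous_subtype_val).subtype_mk _⟩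

/-- The inclusion `V_𝒦 X → V_w X`. -/
def incl : C(𝒦.VK X, ContValuation X) := ⟨Subtype.val, continuous_subtype_val⟩

theorem bind_mem {ϖ : ContValuation (𝒦.VK X)} (h : ϖ ∈ 𝒦.VK (𝒦.VK X)) :
    bind 𝒦.incl ϖ ∈ 𝒦.VK X := by
  refine 𝒦.mapsTo_closure (continuous_bind _) ?_ h
  rintro _ ⟨m, s, y, rfl⟩
  rw [bind_sum]
  exact Submodule.sum_mem _ fun i _ => Submodule.smul_mem _ _ (y i).2

/-- The multiplication `ϖ ↦ (U ↦ ∫ μ(U) dϖ(μ))`. -/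
noncomputable def mult : C(𝒦.VK (𝒦.VK X), 𝒦.VK X) :=
  ⟨fun ϖ => ⟨bind 𝒦.incl ϖ.1, 𝒦.bind_mem ϖ.2⟩,
    ((continuous_bind _).comp continuous_subtype_val).subtype_mk _⟩

theorem mult_unit (μ : 𝒦.VK X) : 𝒦.mult (𝒦.unit μ) = μ :=
  Subtype.ext (bind_dirac 𝒦.incl μ)

theorem mult_map_unit (μ : 𝒦.VK X) : 𝒦.mult (𝒦.mapVK 𝒦.unit μ) = μ := by
  refine Subtype.ext (ContValuation.ext fun U => ?_)
  have h : LowerSemicontinuous fun x : X => dirac x U := lsc_comp continuous_dirac (lsc_eval U)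
  change μ.1.integral (fun x => dirac x U) h = μ.1 U
  have := integral_add_step μ.1 (f := fun _ => 0) lowerSemicontinuous_const h 1 U
    fun x => by rw [dirac_apply, indicator, zero_add]; rfl
  rw [this, integral_zero, zero_add, ENNReal.coe_one, one_mul]

theorem mult_assoc (Φ : 𝒦.VK (𝒦.VK (𝒦.VK X))) :
    𝒦.mult (𝒦.mapVK 𝒦.mult Φ) = 𝒦.mult (𝒦.mult Φ) := by
  refine Subtype.ext (ContValuation.ext fun U => ?_)
  exact (integral_bind 𝒦.incl Φ.1 (lsc_eval_comp 𝒦.incl U)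
    (lsc_comp 𝒦.incl.continuous (lsc_integral _))).symm

end VK

end KCategory

/-- The category of `T₀` spaces and continuous maps. -/
abbrev Top0 := ObjectProperty.FullSubcategory (fun X : TopCat.{u} => T0Space X)

namespace Top0

instance : CoeSort Top0.{u} (Type u) := ⟨fun X => X.obj⟩

instance (X : Top0.{u}) : T0Space X := X.property

/-- A `T₀` space as an object of the category. -/
abbrev of (X : Type u) [TopologicalSpace X] [T0Space X] : Top0.{u} := ⟨TopCat.of X, ‹T0Space X›⟩

/-- A continuous map as a morphism. -/
abbrev ofHom {X Y : Top0.{u}} (f : C(X, Y)) : X ⟶ Y := ObjectProperty.homMk (TopCat.ofHom f)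

/-- The continuous map underlying a morphism. -/
abbrev toMap {X Y : Top0.{u}} (f : X ⟶ Y) : C(X, Y) := f.hom.hom

end Top0

namespace KCategory

variable (𝒦 : KCategory.{u})

/-- The monad `V_𝒦` on the category of `T₀` spaces. -/
noncomputable def monad : Monad Top0.{u} where
  obj X := Top0.of (𝒦.VK X)
  map {X Y} f := Top0.ofHom (X := Top0.of (𝒦.VK X)) (Y := Top0.of (𝒦.VK Y))
    (𝒦.mapVK (Top0.toMap f))
  map_id X := rfl
  map_comp f g := rfl
  η :=
    { app := fun X => Top0.ofHom (Y := Top0.of (𝒦.VK X)) 𝒦.unit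
      naturality := fun X Y f => rfl }
  μ :=
    { app := fun X => Top0.ofHom (X := Top0.of (𝒦.VK (𝒦.VK X))) (Y := Top0.of (𝒦.VK X)) 𝒦.mult
      naturality := fun X Y f => rfl }
  assoc X := by
    apply ObjectProperty.hom_ext
    apply TopCat.hom_ext
    apply ContinuousMap.ext
    intro Φ
    exact 𝒦.mult_assoc Φ
  left_unit X := by
    apply ObjectProperty.hom_ext
    apply TopCat.hom_ext
    apply ContinuousMap.ext
    intro μ
    exact 𝒦.mult_unit μ
  right_unit X := by
    apply ObjectProperty.hom_ext
    apply TopCat.hom_ext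
    apply ContinuousMap.ext
    intro μ
    exact 𝒦.mult_map_unit μ

/-- The structure map of a `V_𝒦`-algebra, as a continuous map `V_𝒦 X → X`. -/
noncomputable abbrev structureMap (A : 𝒦.monad.Algebra) : C(𝒦.VK A.A, A.A) := Top0.toMap A.a

end KCategory

section Cones

variable (C : Type*) [AddCommMonoid C] [Module ℝ≥0 C] [TopologicalSpace C]

/-- A topological cone: a cone (a module over the semiring `ℝ₊`) with a `T₀` topology for which
addition and scalar multiplication are jointly continuous, `ℝ₊` having its Scott topology. -/
structure IsTopologicalCone : Prop where
  t0 : T0Space C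
  continuous_add : Continuous fun p : C × C => p.1 + p.2
  continuous_smul : Continuous fun p : WithScott ℝ≥0 × C => WithScott.ofScott p.1 • p.2

/-- Every open neighbourhood of a point contains a convex (not necessarily open) neighbourhood. -/
def IsWeaklyLocallyConvex : Prop :=
  ∀ (x : C) (U : Set C), IsOpen U → x ∈ U → ∃ A ∈ 𝓝 x, A ⊆ U ∧ Convex ℝ≥0 A

variable {C}

/-- `b` is a barycentre of `ν`: `Λ b = ∫ Λ dν` for every lower semicontinuous linear
`Λ : C → [0, ∞]`. -/
def IsBarycentre (ν : ContValuation C) (b : C) : Prop :=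
  ∀ (Λ : C → ℝ≥0∞) (hΛ : LowerSemicontinuous Λ), IsLinearMap ℝ≥0 Λ → Λ b = ν.integral Λ hΛ

end Cones

namespace KCategory

variable (𝒦 : KCategory.{u})

/-- The structure of a weakly locally convex `𝒦`-cone on a given `T₀` space. -/
structure ConeStr (X : Type u) [TopologicalSpace X] [T0Space X] where
  addCommMonoid : AddCommMonoid X
  module : Module ℝ≥0 X
  isTopologicalCone : IsTopologicalCone X
  isWeaklyLocallyConvex : IsWeaklyLocallyConvex X
  isKSpace : 𝒦.IsKSpace X

/-- Weakly locally convex `𝒦`-cones. -/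
structure Cone where
  space : Top0.{u}
  str : 𝒦.ConeStr space

namespace Cone

variable {𝒦}

instance (C : 𝒦.Cone) : AddCommMonoid C.space := C.str.addCommMonoid

instance (C : 𝒦.Cone) : Module ℝ≥0 C.space := C.str.module

/-- Continuous linear maps of weakly locally convex `𝒦`-cones. -/
@[ext]
structure Hom (C D : 𝒦.Cone) where
  hom : C.space ⟶ D.space
  linear : IsLinearMap ℝ≥0 (Top0.toMap hom)

instance : Category 𝒦.Cone where
  Hom := Hom
  id C := ⟨𝟙 C.space, ⟨fun _ _ => rfl, fun _ _ => rfl⟩⟩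
  comp f g := ⟨f.hom ≫ g.hom,
    ⟨fun x y => (congrArg _ (f.linear.map_add x y)).trans (g.linear.map_add _ _),
      fun r x => (congrArg _ (f.linear.map_smul r x)).trans (g.linear.map_smul _ _)⟩⟩

variable (𝒦) in
/-- The forgetful functor to `T₀` spaces. -/
def forget : 𝒦.Cone ⥤ Top0.{u} where
  obj C := C.space
  map f := f.hom

end Cone

/-- `ρ : V_𝒦 C → C` is linear, maps each valuation to one of its barycentres, and maps each
simple valuation `∑ rᵢ δ_{xᵢ}` to `∑ rᵢ xᵢ`. -/
structure IsBarycentreMap {C : Type u} [AddCommMonoid C] [Module ℝ≥0 C] [TopologicalSpace C]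
    (ρ : C(𝒦.VK C, C)) : Prop where
  linear : IsLinearMap ℝ≥0 ρ
  barycentre : ∀ μ : 𝒦.VK C, IsBarycentre μ.1 (ρ μ)
  simple : ∀ (n : ℕ) (r : Fin n → ℝ≥0) (x : Fin n → C),
    ρ (∑ i, r i • 𝒦.δ (x i)) = ∑ i, r i • x i

end KCategory

end ValuationCones

/-! Everything rests on one density statement. In a sober space the Skula closure of a set is again
sober, hence a `𝒦`-subspace, so the `𝒦`-closure lies inside it (`closure_subset_skulaClosure`).
Continuous maps into `T₀` spaces are determined on the Skula closure by their values on the set, so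
every identity between continuous maps on `V_𝒦 X` may be checked at simple valuations. Extensions
exist because a continuous map into `K` always extends to the Skula closure with values in the sober
space `V_w K`; the points sent to the Dirac copy of `K` form a `𝒦`-subspace containing the original
set, hence its `𝒦`-closure (`exists_extension`).

From cones to algebras, the hard point is that `∑ rᵢ δ_{xᵢ} ↦ ∑ rᵢ xᵢ` is well defined and
continuous for the weak topology (`exists_nhds_sum_smul_mem`). Given `∑ rᵢ xᵢ` in an open `U`, pick
`aᵢ < rᵢ` and small convex neighbourhoods of the `xᵢ`. A simple valuation giving each nonempty union
of their interiors more mass than the sum of the corresponding `aᵢ` can, by a fractional Hall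
theorem, be split into parts of mass at least `aᵢ` in the `i`-th neighbourhood, plus a remainder.
Convexity turns each part into a multiple of a point of its neighbourhood, and the remainder is
harmless because open sets of a topological cone are stable under adding elements. The completion
property then extends the evaluation to `V_𝒦 C`.

From algebras to cones, linearity of `ρ` is associativity at small sums of Dirac masses; the
topology is inherited through `ρ` and the unit, with weakly open convex sets mapped to convex
neighbourhoods. The algebra's space is a `𝒦`-space as a retract of `V_𝒦 X`. Uniqueness on simple
valuations makes the two constructions inverse. -/

namespace ValuationCones

/-! ### Skula closures: sobriety, density, and extension of continuous maps -/

section SkulaClosure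

variable {S : Type*} [TopologicalSpace S]

/-- The closure of `A` in the Skula topology, which is generated by the open and the closed
sets. -/
def skulaClosure (A : Set S) : Set S :=
  {y | ∀ U : Set S, IsOpen U → y ∈ U → ∃ a ∈ A, a ∈ U ∧ y ⤳ a}

theorem subset_skulaClosure (A : Set S) : A ⊆ skulaClosure A :=
  fun y hy _ _ hyU => ⟨y, hy, hyU, specializes_rfl⟩

/-- The generic point `s` of the closure of `F` in `S` already lies in the Skula closure: a
neighbourhood of `s` contains some `b ∈ F`, hence some `a ∈ A` with `b ⤳ a`, and `s ⤳ b ⤳ a`. -/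
instance quasiSober_skulaClosure [QuasiSober S] (A : Set S) : QuasiSober (skulaClosure A) where
  sober := by
    intro F hF hc
    have hI : IsIrreducible (((↑) : skulaClosure A → S) '' F) :=
      hF.image _ continuous_subtype_val.continuousOn
    obtain ⟨s, hs⟩ := QuasiSober.sober hI.closure isClosed_closure
    have hsF : ∀ U : Set S, IsOpen U → s ∈ U → ∃ b ∈ F, (b : S) ∈ U := by
      intro U hU hsU
      obtain ⟨_, hb, b, hbF, rfl⟩ := mem_closure_iff.1 hs.mem U hU hsU
      exact ⟨b, hbF, hb⟩
    have hspec : ∀ b ∈ F, s ⤳ (b : S) := fun b hb =>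
      hs.specializes (subset_closure (mem_image_of_mem _ hb))
    have hsA : s ∈ skulaClosure A := by
      intro U hU hsU
      obtain ⟨b, hbF, hbU⟩ := hsF U hU hsU
      obtain ⟨a, ha, haU, hba⟩ := b.2 U hU hbU
      exact ⟨a, ha, haU, (hspec b hbF).trans hba⟩
    have hmem : (⟨s, hsA⟩ : skulaClosure A) ∈ F := by
      rw [← hc.closure_eq, mem_closure_iff]
      rintro _ ⟨U, hU, rfl⟩ hsU
      obtain ⟨b, hbF, hbU⟩ := hsF U hU hsU
      exact ⟨b, hbU, hbF⟩
    refine ⟨⟨s, hsA⟩, isGenericPoint_iff_specializes.2 fun b => ⟨fun h => ?_, fun h => ?_⟩⟩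
    · exact h.mem_closed hc hmem
    · exact (subtype_specializes_iff _ _).2 (hspec b h)

/-- Continuous maps into a `T₀` space are determined on the Skula closure of a set by their
values on that set. -/
theorem eq_of_mem_skulaClosure {K : Type*} [TopologicalSpace K] [T0Space K] {f g : S → K}
    (hf : Continuous f) (hg : Continuous g) {A : Set S} (h : ∀ a ∈ A, f a = g a) {y : S}
    (hy : y ∈ skulaClosure A) : f y = g y := by
  have key : ∀ {f g : S → K}, Continuous f → Continuous g → (∀ a ∈ A, f a = g a) →
      f y ⤳ g y := by
    intro f g hf hg h
    -- If `g y ∈ V`, some `a ∈ A` has `g a ∈ V` and `y ⤳ a`; then `f y ⤳ f a = g a` forces `f y ∈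
    -- V`.
    refine specializes_iff_forall_open.2 fun V hV hgV => ?_
    obtain ⟨a, ha, haV, hya⟩ := hy _ (hV.preimage hg) hgV
    refine (hya.map hf).mem_open hV ?_
    rw [h a ha]
    exact haV
  exact ((key hf hg h).antisymm (key hg hf fun a ha => (h a ha).symm)).eq

/-- The same argument with superlevel sets in place of open preimages; `ℝ≥0∞` carries its order
topology here, so lower semicontinuous functions are not continuous maps into it. -/
theorem eq_of_lsc_of_mem_skulaClosure {f g : S → ℝ≥0∞} (hf : LowerSemicontinuous f)
    (hg : LowerSemicontinuous g) {A : Set S} (h : ∀ a ∈ A, f a = g a) {y : S}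
    (hy : y ∈ skulaClosure A) : f y = g y := by
  have key : ∀ {f g : S → ℝ≥0∞}, LowerSemicontinuous f → LowerSemicontinuous g →
      (∀ a ∈ A, f a = g a) → g y ≤ f y := by
    intro f g hf hg h
    refine le_of_forall_lt fun r hr => ?_
    obtain ⟨a, ha, har, hya⟩ := hy _ (hg.isOpen_preimage r) hr
    refine hya.mem_open (hf.isOpen_preimage r) ?_
    rw [mem_preimage, h a ha]
    exact har
  exact le_antisymm (key hg hf fun a ha => (h a ha).symm) (key hf hg h)

section Extend

variable {K : Type*} [TopologicalSpace K] {A : Set S} (f : C(A, K))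

/-- The point `y` has a neighbourhood whose trace on `A` is mapped to `V` by `f`. -/
def MapsNear (y : S) (V : Opens K) : Prop :=
  ∃ W : Set S, IsOpen W ∧ y ∈ W ∧ ∀ a : A, (a : S) ∈ W → f a ∈ V

variable {f}

theorem MapsNear.mono {y : S} {U V : Opens K} (h : MapsNear f y U) (hUV : U ≤ V) :
    MapsNear f y V :=
  let ⟨W, hW, hyW, h⟩ := h
  ⟨W, hW, hyW, fun a ha => hUV (h a ha)⟩

theorem mapsNear_inf {y : S} {U V : Opens K} :
    MapsNear f y (U ⊓ V) ↔ MapsNear f y U ∧ MapsNear f y V := by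
  constructor
  · exact fun h => ⟨h.mono inf_le_left, h.mono inf_le_right⟩
  · rintro ⟨⟨W, hW, hyW, h⟩, ⟨W', hW', hyW', h'⟩⟩
    exact ⟨W ∩ W', hW.inter hW', ⟨hyW, hyW'⟩, fun a ha => ⟨h a ha.1, h' a ha.2⟩⟩

theorem mapsNear_of_specializes {y : S} {a : A} (hya : y ⤳ (a : S)) {V : Opens K}
    (h : f a ∈ V) : MapsNear f y V := by
  obtain ⟨W, hW, e⟩ := isOpen_induced_iff.1 (V.isOpen.preimage f.continuous)
  exact ⟨W, hW, hya.mem_open hW ((Set.ext_iff.1 e a).2 h), fun b hb => (Set.ext_iff.1 e b).1 hb⟩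

/-- One point `a ∈ A ∩ W` with `y ⤳ a` decides which member of `D` to take. Together with
`mapsNear_inf` this says that the open sets `V` with `MapsNear f y V` form a completely prime
filter, that is, a point of the sobrification of `K`. -/
theorem mapsNear_sSup {y : S} (hy : y ∈ skulaClosure A) {D : Set (Opens K)} :
    MapsNear f y (sSup D) ↔ ∃ U ∈ D, MapsNear f y U := by
  constructor
  · rintro ⟨W, hW, hyW, h⟩
    obtain ⟨a, ha, haW, hya⟩ := hy W hW hyW
    obtain ⟨U, hU, haU⟩ := Opens.mem_sSup.1 (h ⟨a, ha⟩ haW)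
    exact ⟨U, hU, mapsNear_of_specializes (a := ⟨a, ha⟩) hya haU⟩
  · rintro ⟨U, hU, h⟩
    exact h.mono (le_sSup hU)

variable (f)

open Classical in
/-- The extension of a continuous map on `A` to the Skula closure of `A`, with values in the
`{0, 1}`-valued continuous valuations. -/
noncomputable def skulaExtend (y : S) (hy : y ∈ skulaClosure A) : ContValuation K where
  toFun V := if MapsNear f y V then 1 else 0
  map_bot' := by
    rw [← sSup_empty, mapsNear_sSup hy]
    simp
  mono' U V hUV := by
    by_cases h : MapsNear f y U
    · simp [h, h.mono hUV]
    · simp [h]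
  modular' U V := by
    -- Joins become disjunctions and meets conjunctions, so modularity is a check of four cases.
    rw [← sSup_pair, mapsNear_sSup hy, mapsNear_inf]
    by_cases hU : MapsNear f y U <;> by_cases hV : MapsNear f y V <;> simp [hU, hV]
  scott' D hD hd := by
    rw [mapsNear_sSup hy]
    by_cases hx : ∃ U ∈ D, MapsNear f y U
    · rw [if_pos hx]
      obtain ⟨U, hU, h⟩ := hx
      refine le_antisymm ?_ (iSup₂_le fun V _ => by split_ifs <;> simp)
      refine le_trans ?_ (le_iSup₂ U hU)
      rw [if_pos h]
    · rw [if_neg hx]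
      symm
      simp only [ENNReal.iSup_eq_zero]
      exact fun U hU => if_neg fun h => hx ⟨U, hU, h⟩

/-- The open set `W` witnessing `MapsNear f y V` serves all its points at once. -/
theorem continuous_skulaExtend :
    Continuous fun y : skulaClosure A => skulaExtend f y y.2 := by
  classical
  refine ContValuation.continuous_of_lsc fun V y r hr => ?_
  change r < ite _ _ _ at hr
  split_ifs at hr with h
  · obtain ⟨W, hW, hyW, h⟩ := h
    filter_upwards [(hW.preimage continuous_subtype_val).mem_nhds hyW] with z hz
    change r < ite _ _ _
    rwa [if_pos ⟨W, hW, hz, h⟩]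
  · exact absurd hr not_lt_zero

theorem skulaExtend_coe (a : A) (ha : (a : S) ∈ skulaClosure A) :
    skulaExtend f a ha = ContValuation.dirac (f a) := by
  classical
  refine ContValuation.ext fun V => ?_
  rw [ContValuation.dirac_apply]
  refine if_congr ⟨?_, mapsNear_of_specializes specializes_rfl⟩ rfl rfl
  rintro ⟨W, -, haW, h⟩
  exact h a haW

end Extend

end SkulaClosure

/-! ### The Dirac embedding and `𝒦`-completions -/

/-- An open `U` is the preimage of `[U > 0]`. This realises every `T₀` space inside a sober one,
where the axioms of a `𝒦`-category apply. -/
theorem ContValuation.isEmbedding_dirac {X : Type*} [TopologicalSpace X] [T0Space X] :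
    IsEmbedding (ContValuation.dirac : X → ContValuation X) := by
  classical
  have hi : IsInducing (ContValuation.dirac : X → ContValuation X) := by
    refine ⟨le_antisymm ContValuation.continuous_dirac.le_induced fun U hU => ?_⟩
    refine ⟨{μ | (0 : ℝ≥0∞) < μ ⟨U, hU⟩},
      (ContValuation.lsc_eval (⟨U, hU⟩ : Opens X)).isOpen_preimage 0, ?_⟩
    ext x
    by_cases hx : x ∈ U <;> simp [ContValuation.dirac_apply, hx]
  exact hi.isEmbedding

namespace KCategory

variable (𝒦 : KCategory.{u})

section Completion

variable {S : Type u} [TopologicalSpace S] [T0Space S] [QuasiSober S]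

/-- The Skula closure is sober, so it is one of the `𝒦`-subspaces being intersected. -/
theorem closure_subset_skulaClosure (A : Set S) : 𝒦.closure A ⊆ skulaClosure A :=
  fun _ hx => hx _ ⟨subset_skulaClosure A, 𝒦.of_sober _⟩

/-- The points of `𝒦.closure A` that lie in `A` are Skula dense in it. -/
theorem mem_skulaClosure_preimage {A : Set S} (y : 𝒦.closure A) :
    y ∈ skulaClosure (((↑) : 𝒦.closure A → S) ⁻¹' A) := by
  rintro _ ⟨U, hU, rfl⟩ hyU
  obtain ⟨a, ha, haU, hya⟩ := 𝒦.closure_subset_skulaClosure A y.2 U hU hyU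
  exact ⟨⟨a, 𝒦.subset_closure A ha⟩, ha, haU, (subtype_specializes_iff _ _).2 hya⟩

theorem exists_extension (A : Set S) {K : Type u} [TopologicalSpace K] [T0Space K]
    (hK : 𝒦.IsKSpace K) (f : C(A, K)) :
    ∃ φ : C(𝒦.closure A, K), ∀ a : A, φ ⟨a, 𝒦.subset_closure A a.2⟩ = f a := by
  let φ : skulaClosure A → ContValuation K := fun y => skulaExtend f y y.2
  have hφ : Continuous φ := continuous_skulaExtend f
  let R : Set (ContValuation K) := Set.range ContValuation.dirac
  have hR : 𝒦.IsKSpace R :=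
    𝒦.of_homeomorph _ _ ContValuation.isEmbedding_dirac.toHomeomorph hK
  have hP : 𝒦.IsKSpace (φ ⁻¹' R) := 𝒦.preimage _ _ φ hφ R hR
  -- The preimage axiom gives a `𝒦`-subspace of `skulaClosure A`. Its homeomorphic image in `S`
  -- contains `A`, hence all of `𝒦.closure A`.
  let B : Set S := (↑) '' (φ ⁻¹' R)
  have hB : 𝒦.IsKSpace B := 𝒦.of_homeomorph _ _
    (IsEmbedding.subtypeVal.homeomorphImage (φ ⁻¹' R)) hP
  have hAB : A ⊆ B := fun a ha =>
    ⟨⟨a, subset_skulaClosure A ha⟩, ⟨f ⟨a, ha⟩, (skulaExtend_coe f ⟨a, ha⟩ _).symm⟩, rfl⟩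
  have hy : ∀ y : 𝒦.closure A, φ ⟨y, 𝒦.closure_subset_skulaClosure A y.2⟩ ∈ R := by
    intro y
    obtain ⟨z, hz, e⟩ := y.2 B ⟨hAB, hB⟩
    obtain rfl : z = ⟨y, 𝒦.closure_subset_skulaClosure A y.2⟩ := Subtype.ext e
    exact hz
  let e := (ContValuation.isEmbedding_dirac (X := K)).toHomeomorph
  refine ⟨⟨fun y => e.symm ⟨_, hy y⟩, e.symm.continuous.comp
    ((hφ.comp (continuous_subtype_val.subtype_mk _)).subtype_mk _)⟩, fun a => ?_⟩
  refine e.symm_apply_eq.2 (Subtype.ext ?_)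
  exact skulaExtend_coe f a (subset_skulaClosure A a.2)

theorem closure_hom_ext {A : Set S} {K : Type*} [TopologicalSpace K] [T0Space K]
    {φ ψ : 𝒦.closure A → K} (hφ : Continuous φ) (hψ : Continuous ψ)
    (h : ∀ y : 𝒦.closure A, (y : S) ∈ A → φ y = ψ y) (y : 𝒦.closure A) : φ y = ψ y :=
  eq_of_mem_skulaClosure hφ hψ h (𝒦.mem_skulaClosure_preimage y)

end Completion

/-- A retract of a `𝒦`-space is a `𝒦`-space. -/
theorem isKSpace_of_retract {X Y : Type u} [TopologicalSpace X] [T0Space X] [TopologicalSpace Y]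
    [T0Space Y] (hY : 𝒦.IsKSpace Y) (s : C(X, Y)) (r : C(Y, X)) (h : ∀ x, r (s x) = x) :
    𝒦.IsKSpace X := by
  -- Compare `X` with its completion, the `𝒦`-closure of its Dirac copy: `s` extends to `φ` on the
  -- completion, and `r ∘ φ` turns out to be inverse to the inclusion.
  let A : Set (ContValuation X) := Set.range ContValuation.dirac
  let e : X ≃ₜ A := (ContValuation.isEmbedding_dirac (X := X)).toHomeomorph
  let i : A → 𝒦.closure A := fun a => ⟨a, 𝒦.subset_closure A a.2⟩
  have hi : Continuous i := continuous_subtype_val.subtype_mk _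
  obtain ⟨φ, hφ⟩ := 𝒦.exists_extension A hY (s.comp ⟨e.symm, e.symm.continuous⟩)
  have h1 : ∀ x, r (φ (i (e x))) = x := fun x => by
    rw [hφ (e x)]
    simp [h]
  -- Both sides are continuous and agree on the Dirac masses, which are Skula dense.
  have h2 : ∀ y, i (e (r (φ y))) = y := by
    refine 𝒦.closure_hom_ext (by fun_prop) continuous_id fun y hy => ?_
    obtain ⟨x, hx⟩ := hy
    obtain rfl : i (e x) = y := Subtype.ext hx
    simp [h1]
  exact 𝒦.of_homeomorph _ _
    { toFun := fun y => r (φ y)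
      invFun := fun x => i (e x)
      left_inv := h2
      right_inv := h1
      continuous_toFun := by fun_prop
      continuous_invFun := by fun_prop } (𝒦.isKSpace_closure A)

section VK

variable {X : Type u} [TopologicalSpace X]

theorem isKSpace_VK : 𝒦.IsKSpace (𝒦.VK X) := 𝒦.isKSpace_closure _

theorem isKCompletion_simpleIncl : 𝒦.IsKCompletion (𝒦.simpleIncl : _ → 𝒦.VK X) := by
  refine ⟨𝒦.isKSpace_VK, ?_, ?_⟩
  · refine IsEmbedding.of_comp (continuous_subtype_val.subtype_mk _) continuous_subtype_val ?_
    exact IsEmbedding.subtypeVal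
  · intro K _ _ hK f hf
    obtain ⟨φ, hφ⟩ := 𝒦.exists_extension {μ : ContValuation X | μ.IsSimple} hK ⟨f, hf⟩
    refine ⟨φ, hφ, fun ψ hψ => ContinuousMap.ext ?_⟩
    refine 𝒦.closure_hom_ext ψ.continuous φ.continuous fun y hy => ?_
    exact (hψ ⟨y, hy⟩).trans (hφ ⟨y, hy⟩).symm

/-- Continuous maps on `V_𝒦 X` are determined by their values at the simple valuations. -/
theorem VK_hom_ext {K : Type*} [TopologicalSpace K] [T0Space K] {φ ψ : 𝒦.VK X → K}
    (hφ : Continuous φ) (hψ : Continuous ψ)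
    (h : ∀ (n : ℕ) (r : Fin n → ℝ≥0) (x : Fin n → X),
      φ (∑ i, r i • 𝒦.δ (x i)) = ψ (∑ i, r i • 𝒦.δ (x i))) (μ : 𝒦.VK X) : φ μ = ψ μ := by
  refine 𝒦.closure_hom_ext (A := {μ : ContValuation X | μ.IsSimple}) hφ hψ ?_ μ
  rintro μ ⟨n, r, x, e⟩
  obtain rfl : (∑ i, r i • 𝒦.δ (x i) : 𝒦.VK X) = μ := Subtype.ext (by rw [e]; simp [δ])
  exact h n r x

/-- Used for the barycentre identity, whose two sides are lower semicontinuous in the valuation. -/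
theorem VK_lsc_ext {φ ψ : 𝒦.VK X → ℝ≥0∞} (hφ : LowerSemicontinuous φ)
    (hψ : LowerSemicontinuous ψ) (h : ∀ (n : ℕ) (r : Fin n → ℝ≥0) (x : Fin n → X),
      φ (∑ i, r i • 𝒦.δ (x i)) = ψ (∑ i, r i • 𝒦.δ (x i))) (μ : 𝒦.VK X) : φ μ = ψ μ := by
  refine eq_of_lsc_of_mem_skulaClosure hφ hψ ?_
    (𝒦.mem_skulaClosure_preimage (A := {μ : ContValuation X | μ.IsSimple}) μ)
  rintro μ ⟨n, r, x, e⟩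
  obtain rfl : (∑ i, r i • 𝒦.δ (x i) : 𝒦.VK X) = μ := Subtype.ext (by rw [e]; simp [δ])
  exact h n r x

end VK

end KCategory

/-! ### Transport of finite masses -/

/-- A fractional version of Hall's marriage theorem. -/
theorem exists_transport {ι κ : Type*} [Fintype ι] [Fintype κ] (R : ι → κ → Prop)
    [∀ i j, Decidable (R i j)] (r : ι → ℝ≥0) (s : κ → ℝ≥0)
    (h : ∀ I : Finset ι, I.Nonempty →
      ∑ i ∈ I, r i < ∑ j ∈ Finset.univ.filter (fun j => ∃ i ∈ I, R i j), s j) :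
    ∃ t : ι → κ → ℝ≥0, (∀ i, r i ≤ ∑ j, t i j) ∧ (∀ j, ∑ i, t i j ≤ s j) ∧
      ∀ i j, t i j ≠ 0 → R i j := by
  classical
  let nb : Finset ι → Finset κ := fun I => Finset.univ.filter (fun j => ∃ i ∈ I, R i j)
  -- A bound for the total rounding error when `n rᵢ` is rounded up and `n sⱼ` down. The strict
  -- inequalities leave a positive gap for each of the finitely many `I`, so for large `n` every gap
  -- times `n` exceeds or equals `M`.
  let M : ℝ := Fintype.card ι + Fintype.card κ
  obtain ⟨n, hn0, hn⟩ : ∃ n : ℕ, 0 < n ∧ ∀ I : Finset ι, I.Nonempty →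
      (n : ℝ) * ∑ i ∈ I, (r i : ℝ) + M ≤ n * ∑ j ∈ nb I, (s j : ℝ) := by
    have h1 : ∀ I : Finset ι, ∀ᶠ n : ℕ in atTop, I.Nonempty →
        (n : ℝ) * ∑ i ∈ I, (r i : ℝ) + M ≤ n * ∑ j ∈ nb I, (s j : ℝ) := by
      intro I
      by_cases hI : I.Nonempty
      · have hd : 0 < ∑ j ∈ nb I, (s j : ℝ) - ∑ i ∈ I, (r i : ℝ) := by
          have := h I hI
          rw [sub_pos]
          exact_mod_cast this
        have ht : Tendsto (fun n : ℕ => (n : ℝ) * (∑ j ∈ nb I, (s j : ℝ) - ∑ i ∈ I, (r i : ℝ)))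
          atTop atTop := tendsto_natCast_atTop_atTop.atTop_mul_const hd
        filter_upwards [ht.eventually_ge_atTop M] with n hn _
        linarith
      · exact Eventually.of_forall fun n h => absurd h hI
    obtain ⟨n, hn0, hn⟩ := ((eventually_gt_atTop 0).and (eventually_all.2 h1)).exists
    exact ⟨n, hn0, hn⟩
  have hn0' : (0 : ℝ) < n := by exact_mod_cast hn0
  let a : ι → ℕ := fun i => ⌈(n : ℝ) * r i⌉₊
  let b : κ → ℕ := fun j => ⌊(n : ℝ) * s j⌋₊
  have hab : ∀ I : Finset ι, ∑ i ∈ I, a i ≤ ∑ j ∈ nb I, b j := by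
    intro I
    rcases I.eq_empty_or_nonempty with rfl | hI
    · simp
    have h1 : ∑ i ∈ I, (a i : ℝ) ≤ n * ∑ i ∈ I, (r i : ℝ) + Fintype.card ι := by
      calc ∑ i ∈ I, (a i : ℝ) ≤ ∑ i ∈ I, ((n : ℝ) * r i + 1) :=
            Finset.sum_le_sum fun i _ => (Nat.ceil_lt_add_one (by positivity)).le
        _ = n * ∑ i ∈ I, (r i : ℝ) + I.card := by
            rw [Finset.sum_add_distrib, Finset.mul_sum]; simp
        _ ≤ _ := by gcongr; exact Finset.card_le_univ I
    have h2 : n * ∑ j ∈ nb I, (s j : ℝ) ≤ ∑ j ∈ nb I, (b j : ℝ) + Fintype.card κ := by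
      calc n * ∑ j ∈ nb I, (s j : ℝ) ≤ ∑ j ∈ nb I, ((b j : ℝ) + 1) := by
            rw [Finset.mul_sum]
            exact Finset.sum_le_sum fun j _ => (Nat.lt_floor_add_one _).le
        _ = ∑ j ∈ nb I, (b j : ℝ) + (nb I).card := by
            rw [Finset.sum_add_distrib]; simp
        _ ≤ _ := by gcongr; exact Finset.card_le_univ _
    have h3 := hn I hI
    have h4 : ∑ i ∈ I, (a i : ℝ) ≤ ∑ j ∈ nb I, (b j : ℝ) := by
      simp only [M] at h3
      linarith
    exact_mod_cast h4
  -- The integral marriage theorem for `a i` copies of each `i` and `b j` copies of each `j`. Hall's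
  -- condition for a set of copies follows from `hab` for its set of indices, since adding further
  -- copies of these indices creates no new neighbours.
  obtain ⟨f, hf, hfR⟩ := (Finset.all_card_le_biUnion_card_iff_exists_injective
    (fun p : Σ i, Fin (a i) => (Finset.univ.filter (R p.1)).sigma
      fun j => (Finset.univ : Finset (Fin (b j))))).1 (by
    intro P
    let I : Finset ι := P.image Sigma.fst
    have h1 : P ⊆ I.sigma fun i => (Finset.univ : Finset (Fin (a i))) := fun p hp =>
      Finset.mem_sigma.2 ⟨Finset.mem_image_of_mem _ hp, Finset.mem_univ _⟩
    have h2 : ((nb I).sigma fun j => (Finset.univ : Finset (Fin (b j)))) ⊆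
        P.biUnion fun p : Σ i, Fin (a i) => (Finset.univ.filter (R p.1)).sigma
      fun j => (Finset.univ : Finset (Fin (b j))) := by
      rintro ⟨j, k⟩ hj
      simp only [Finset.mem_sigma, Finset.mem_univ, and_true, nb, Finset.mem_filter, true_and,
        I, Finset.mem_image, Finset.mem_biUnion] at hj ⊢
      obtain ⟨_, ⟨p, hp, rfl⟩, hR⟩ := hj
      exact ⟨p, hp, hR⟩
    refine (Finset.card_le_card h1).trans (le_trans ?_ (Finset.card_le_card h2))
    simpa [Finset.card_sigma] using hab I)
  -- The number of copies of `i` matched with copies of `j`; the transport plan is `N / n`.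
  let N : ι → κ → ℕ := fun i j =>
    (Finset.univ.filter fun k : Fin (a i) => (f ⟨i, k⟩).1 = j).card
  have hN1 : ∀ i, ∑ j, N i j = a i := by
    intro i
    have := Finset.card_eq_sum_card_fiberwise (s := (Finset.univ : Finset (Fin (a i))))
      (t := Finset.univ) (f := fun k => (f ⟨i, k⟩).1)
      (fun _ _ => Finset.mem_coe.2 (Finset.mem_univ _))
    rw [Finset.card_univ, Fintype.card_fin] at this
    exact this.symm
  have hN2 : ∀ j, ∑ i, N i j ≤ b j := by
    intro j
    have : ∑ i, N i j = (Finset.univ.sigma fun i =>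
        Finset.univ.filter fun k : Fin (a i) => (f ⟨i, k⟩).1 = j).card := by
      rw [Finset.card_sigma]
    rw [this]
    calc _ = ((Finset.univ.sigma fun i =>
          Finset.univ.filter fun k : Fin (a i) => (f ⟨i, k⟩).1 = j).image f).card :=
          (Finset.card_image_of_injective _ hf).symm
      _ ≤ (({j} : Finset κ).sigma fun j => (Finset.univ : Finset (Fin (b j)))).card := by
          refine Finset.card_le_card ?_
          intro q hq
          obtain ⟨⟨i, k⟩, hp, rfl⟩ := Finset.mem_image.1 hq
          simpa using hp
      _ = b j := by simp [Finset.card_sigma]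
  refine ⟨fun i j => N i j / n, fun i => ?_, fun j => ?_, fun i j hij => ?_⟩
  · rw [← Finset.sum_div, ← Nat.cast_sum, hN1]
    rw [le_div_iff₀ (by exact_mod_cast hn0), ← NNReal.coe_le_coe]
    push_cast
    rw [mul_comm]
    exact Nat.le_ceil _
  · rw [← Finset.sum_div, ← Nat.cast_sum, div_le_iff₀ (by exact_mod_cast hn0),
      ← NNReal.coe_le_coe]
    push_cast
    have h1 : ((∑ i, N i j : ℕ) : ℝ) ≤ b j := by exact_mod_cast hN2 j
    push_cast at h1
    refine h1.trans ((Nat.floor_le (by positivity)).trans_eq (mul_comm _ _))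
  · have : N i j ≠ 0 := fun h0 => hij (by simp [h0])
    obtain ⟨k, hk⟩ := Finset.card_ne_zero.1 this
    have hk := (Finset.mem_filter.1 hk).2
    have := (Finset.mem_sigma.1 (hfR ⟨i, k⟩)).1
    rw [hk] at this
    exact (Finset.mem_filter.1 this).2

/-! ### The Scott topology on scalars -/

section Scott

theorem isOpen_ofScott_Ioi (a : ℝ≥0) : IsOpen {r : WithScott ℝ≥0 | a < WithScott.ofScott r} := by
  have : IsClosed (Iic (WithScott.toScott a)) := isClosed_Iic
  convert this.isOpen_compl using 1
  ext r
  exact (not_le (a := WithScott.ofScott r) (b := a)).symm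

/-- For `r > 0` the set `Iio r` is nonempty and directed with supremum `r`, so a Scott open set
containing `r` meets it. -/
theorem exists_lt_mem_of_isOpen_withScott {O : Set (WithScott ℝ≥0)} (hO : IsOpen O) {r : ℝ≥0}
    (hr : 0 < r) (h : WithScott.toScott r ∈ O) : ∃ a < r, WithScott.toScott a ∈ O := by
  have hs := (IsScott.isOpen_iff_isUpperSet_and_dirSupInaccOn (D := univ)).1 hO
  have hne : (Iio r).Nonempty := ⟨0, hr⟩
  obtain ⟨a, ha, haO⟩ := hs.2 (d := (Iio r : Set ℝ≥0)) trivial hne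
    (show DirectedOn (· ≤ ·) (Iio r) from (isChain_of_trichotomous _).directedOn)
    (show IsLUB (Iio r) r from isLUB_Iio) h
  exact ⟨a, ha, haO⟩

theorem mem_of_isOpen_withScott_of_le {O : Set (WithScott ℝ≥0)} (hO : IsOpen O) {r s : ℝ≥0}
    (h : WithScott.toScott r ∈ O) (hrs : r ≤ s) : WithScott.toScott s ∈ O :=
  IsScott.isUpperSet_of_isOpen (D := univ) hO hrs h

/-- A product in `ℝ≥0∞` is the supremum of the products of strictly smaller factors. Multiplication
is discontinuous at `(0, ∞)`, so this cannot be had by composing with a continuous map. -/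
theorem lowerSemicontinuous_mul {Z : Type*} [TopologicalSpace Z] {f g : Z → ℝ≥0∞}
    (hf : LowerSemicontinuous f) (hg : LowerSemicontinuous g) :
    LowerSemicontinuous fun z => f z * g z := by
  intro z q hq
  obtain ⟨a, ha, b, hb, hab⟩ : ∃ a < f z, ∃ b < g z, q < a * b := by
    by_contra! h
    exact hq.not_ge (ENNReal.mul_le_of_forall_lt h)
  filter_upwards [hf z a ha, hg z b hb] with w h1 h2
  exact hab.trans_le (mul_le_mul' h1.le h2.le)

theorem lsc_ofScott : LowerSemicontinuous fun r : WithScott ℝ≥0 =>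
    ((WithScott.ofScott r : ℝ≥0) : ℝ≥0∞) := by
  intro r q hq
  obtain ⟨a, hqa, har⟩ := ENNReal.lt_iff_exists_nnreal_btwn.1 hq
  filter_upwards [(isOpen_ofScott_Ioi a).mem_nhds (ENNReal.coe_lt_coe.1 har)] with s hs
  exact hqa.trans (ENNReal.coe_lt_coe.2 hs)

end Scott

/-! ### Cone structure and local convexity of the weak topology -/

namespace ContValuation

variable {X : Type*} [TopologicalSpace X]

instance : ContinuousAdd (ContValuation X) :=
  ⟨continuous_of_lsc fun U => (lsc_comp continuous_fst (lsc_eval U)).add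
    (lsc_comp continuous_snd (lsc_eval U))⟩

theorem isTopologicalCone : IsTopologicalCone (ContValuation X) where
  t0 := inferInstance
  continuous_add := continuous_add
  continuous_smul := continuous_of_lsc fun U => lowerSemicontinuous_mul
    (lsc_comp continuous_fst lsc_ofScott) (lsc_comp continuous_snd (lsc_eval U))

/-- Evaluation at an open set as a linear map. -/
def evalLinear (U : Opens X) : ContValuation X →ₗ[ℝ≥0] ℝ≥0∞ where
  toFun μ := μ U
  map_add' _ _ := rfl
  map_smul' _ _ := rfl

/-- Integration of a fixed function as a linear map. -/
noncomputable def integralLinear {h : X → ℝ≥0∞} (hh : LowerSemicontinuous h) :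
    ContValuation X →ₗ[ℝ≥0] ℝ≥0∞ where
  toFun μ := μ.integral h hh
  map_add' μ ν := integral_add_val μ ν hh
  map_smul' r μ := integral_smul_val r μ hh

open Classical in
theorem sum_dirac_apply {ι : Type*} (s : Finset ι) (r : ι → ℝ≥0) (x : ι → X) (U : Opens X) :
    (∑ i ∈ s, r i • dirac (x i) : ContValuation X) U =
      ((∑ i ∈ s.filter (fun i => x i ∈ U), r i : ℝ≥0) : ℝ≥0∞) := by
  change evalLinear U _ = _
  rw [_root_.map_sum, Finset.sum_filter, ENNReal.ofNNReal_finsetSum]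
  refine Finset.sum_congr rfl fun i _ => ?_
  rw [_root_.map_smul]
  change r i • dirac (x i) U = _
  rw [dirac_apply, ENNReal.smul_def]
  split_ifs <;> simp

theorem integral_sum_dirac {ι : Type*} (s : Finset ι) (r : ι → ℝ≥0) (x : ι → X) {h : X → ℝ≥0∞}
    (hh : LowerSemicontinuous h) :
    (∑ i ∈ s, r i • dirac (x i) : ContValuation X).integral h hh = ∑ i ∈ s, r i • h (x i) := by
  change integralLinear hh _ = _
  simp only [_root_.map_sum, _root_.map_smul]
  exact Finset.sum_congr rfl fun i _ => congrArg _ (integral_dirac (x i) hh)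

/-- The basic open sets of the weak topology are convex. -/
theorem exists_convex_open_subset {μ : ContValuation X} {O : Set (ContValuation X)}
    (hO : IsOpen O) (hμ : μ ∈ O) : ∃ W, IsOpen W ∧ μ ∈ W ∧ W ⊆ O ∧ Convex ℝ≥0 W := by
  obtain ⟨_, ⟨F, ⟨hF, hF'⟩, rfl⟩, hμF, hFO⟩ :=
    (isTopologicalBasis_of_subbasis rfl).exists_subset_of_mem_open hμ hO
  refine ⟨_, hF.isOpen_sInter fun W hW => isOpen_generateFrom_of_mem (hF' hW), hμF, hFO,
    convex_sInter fun W hW => ?_⟩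
  obtain ⟨U, r, rfl⟩ := hF' hW
  intro ν (hν : r < ν U) κ (hκ : r < κ U) a b _ _ hab
  -- Passing through the minimum keeps the inequality strict even when one weight vanishes.
  refine (lt_min hν hκ).trans_le ?_
  calc min (ν U) (κ U) = a * min (ν U) (κ U) + b * min (ν U) (κ U) := by
        rw [← add_mul, ← ENNReal.coe_add, hab, ENNReal.coe_one, one_mul]
    _ ≤ a * ν U + b * κ U := by
        gcongr
        · exact min_le_left _ _
        · exact min_le_right _ _

end ContValuation

/-- A finite linear combination of points of a nonempty convex set is a multiple of a point of that
set. -/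
theorem exists_smul_eq_sum_of_convex {C : Type*} [AddCommMonoid C] [Module ℝ≥0 C]
    {A : Set C} (hA : Convex ℝ≥0 A) (hne : A.Nonempty)
    {κ : Type*} (s : Finset κ) (t : κ → ℝ≥0) (y : κ → C) (h : ∀ j ∈ s, t j ≠ 0 → y j ∈ A) :
    ∃ a ∈ A, ∑ j ∈ s, t j • y j = (∑ j ∈ s, t j) • a := by
  classical
  induction s using Finset.induction_on with
  | empty =>
    obtain ⟨a, ha⟩ := hne
    exact ⟨a, ha, by simp⟩
  | insert j s hj ih =>
    obtain ⟨a, ha, e⟩ := ih fun i hi => h i (Finset.mem_insert_of_mem hi)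
    rw [Finset.sum_insert hj, Finset.sum_insert hj, e]
    by_cases ht : t j = 0
    · exact ⟨a, ha, by simp [ht]⟩
    -- The new total is nonzero, so the point `y j` and the earlier point `a` can be averaged with
    -- normalised weights.
    · have hp : t j + ∑ i ∈ s, t i ≠ 0 := by
        rw [Ne, add_eq_zero]
        exact fun h => ht h.1
      refine ⟨(t j / (t j + ∑ i ∈ s, t i)) • y j +
        ((∑ i ∈ s, t i) / (t j + ∑ i ∈ s, t i)) • a, ?_, ?_⟩
      · refine hA (h j (Finset.mem_insert_self _ _) ht) ha zero_le zero_le ?_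
        rw [← add_div, div_self hp]
      · rw [smul_add, smul_smul, smul_smul, mul_div_cancel₀ _ hp, mul_div_cancel₀ _ hp]

/-! ### Evaluating simple valuations in a weakly locally convex cone -/

section TopologicalCone

variable {C : Type*} [AddCommMonoid C] [Module ℝ≥0 C] [TopologicalSpace C]

namespace IsTopologicalCone

/-- Joint continuity gives a product neighbourhood whose Scott open factor is an upper set reaching
strictly below `r`. This slack supplies the strict inequalities needed for a weakly open
neighbourhood. -/
theorem exists_smul_mem (hC : IsTopologicalCone C) {U : Set C} (hU : IsOpen U) {r : ℝ≥0}
    (hr : 0 < r) {x : C} (hx : r • x ∈ U) : ∃ a < r, ∃ W : Set C, IsOpen W ∧ x ∈ W ∧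
      ∀ s, a ≤ s → ∀ w ∈ W, s • w ∈ U := by
  obtain ⟨O, W, hO, hW, hrO, hxW, h⟩ := isOpen_prod_iff.1 (hU.preimage hC.continuous_smul)
    (WithScott.toScott r) x hx
  obtain ⟨a, har, haO⟩ := exists_lt_mem_of_isOpen_withScott hO hr hrO
  exact ⟨a, har, W, hW, hxW, fun s hs w hw =>
    h (mk_mem_prod (mem_of_isOpen_withScott_of_le hO haO hs) hw)⟩

/-- The scalars `r` with `z + r • w ∈ U` form a Scott open set; it contains `0`, hence `1`. -/
theorem add_mem (hC : IsTopologicalCone C) {U : Set C} (hU : IsOpen U) {z : C} (hz : z ∈ U)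
    (w : C) : z + w ∈ U := by
  have hc : Continuous fun r : WithScott ℝ≥0 => z + WithScott.ofScott r • w :=
    hC.continuous_add.comp (continuous_const.prodMk
      (hC.continuous_smul.comp (continuous_id.prodMk continuous_const)))
  have h0 : WithScott.toScott (0 : ℝ≥0) ∈
      (fun r : WithScott ℝ≥0 => z + WithScott.ofScott r • w) ⁻¹' U := by
    simpa using hz
  simpa using mem_of_isOpen_withScott_of_le (hU.preimage hc) h0 (zero_le (a := (1 : ℝ≥0)))

theorem continuous_const_smul (hC : IsTopologicalCone C) (r : ℝ≥0) :
    Continuous fun x : C => r • x :=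
  hC.continuous_smul.comp ((continuous_const (y := WithScott.toScott r)).prodMk continuous_id)

theorem comp_induced {D : Type*} [AddCommMonoid D] [Module ℝ≥0 D] [TopologicalSpace D]
    (hC : IsTopologicalCone C) (f : D →ₗ[ℝ≥0] C) (hf : IsEmbedding f) : IsTopologicalCone D where
  t0 := have := hC.t0; hf.t0Space
  continuous_add := by
    refine hf.continuous_iff.2 ?_
    simp only [Function.comp_def, map_add]
    exact hC.continuous_add.comp (hf.continuous.prodMap hf.continuous)
  continuous_smul := by
    refine hf.continuous_iff.2 ?_
    simp only [Function.comp_def, map_smul]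
    exact hC.continuous_smul.comp (continuous_id.prodMap hf.continuous)

end IsTopologicalCone

/-- The analytic core. The neighbourhood `N` is Hall's condition for the masses `a i`, phrased with
interiors because the convex neighbourhoods need not be open while valuations measure only open
sets. -/
theorem exists_nhds_sum_smul_mem_of_pos (hC : IsTopologicalCone C) (hW : IsWeaklyLocallyConvex C)
    {ι : Type*} [Fintype ι] (r : ι → ℝ≥0) (hr : ∀ i, 0 < r i) (x : ι → C) {U : Set C}
    (hU : IsOpen U) (hx : ∑ i, r i • x i ∈ U) :
    ∃ N : Set (ContValuation C), IsOpen N ∧ ∑ i, r i • ContValuation.dirac (x i) ∈ N ∧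
      ∀ (n : ℕ) (s : Fin n → ℝ≥0) (y : Fin n → C),
        ∑ j, s j • ContValuation.dirac (y j) ∈ N → ∑ j, s j • y j ∈ U := by
  classical
  have : ContinuousAdd C := ⟨hC.continuous_add⟩
  obtain ⟨V, hV, hVU⟩ := isOpen_pi_iff'.1 (hU.preimage
    (show Continuous fun w : ι → C => ∑ i, w i by fun_prop)) (fun i => r i • x i) hx
  choose a har V' hV' hxV' haV' using fun i => hC.exists_smul_mem (hV i).1 (hr i) (hV i).2
  choose A hA hAV hAc using fun i => hW (x i) (V' i) (hV' i) (hxV' i)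
  let W : ι → Opens C := fun i => ⟨interior (A i), isOpen_interior⟩
  have hxW : ∀ i, x i ∈ W i := fun i => mem_interior_iff_mem_nhds.2 (hA i)
  refine ⟨⋂ I : {I : Finset ι // I.Nonempty},
    {ν | ((∑ i ∈ I.1, a i : ℝ≥0) : ℝ≥0∞) < ν (⨆ i ∈ I.1, W i)}, ?_, ?_, ?_⟩
  · exact isOpen_iInter_of_finite fun I => (ContValuation.lsc_eval _).isOpen_preimage _
  · refine mem_iInter.2 fun ⟨I, hI⟩ => ?_
    change _ < (∑ i, r i • ContValuation.dirac (x i) : ContValuation C) _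
    rw [ContValuation.sum_dirac_apply, ENNReal.coe_lt_coe]
    refine (Finset.sum_lt_sum_of_nonempty hI fun i _ => har i).trans_le ?_
    refine Finset.sum_le_sum_of_subset fun i hi => ?_
    rw [Finset.mem_filter]
    exact ⟨Finset.mem_univ _, (le_iSup₂ (f := fun i (_ : i ∈ I) => W i) i hi) (hxW i)⟩
  · intro n s y hN
    -- `t i j` is the part of the mass at `y j` assigned to `x i`.
    obtain ⟨t, ht1, ht2, ht3⟩ := exists_transport (fun i j => y j ∈ W i) a s fun I hI => by
      have h := mem_iInter.1 hN ⟨I, hI⟩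
      change _ < (∑ j, s j • ContValuation.dirac (y j) : ContValuation C) _ at h
      rw [ContValuation.sum_dirac_apply, ENNReal.coe_lt_coe] at h
      simpa only [Opens.mem_iSup, exists_prop] using h
    choose z hz hzt using fun i => exists_smul_eq_sum_of_convex (hAc i)
      ⟨x i, mem_of_mem_nhds (hA i)⟩ Finset.univ (t i) y
      fun j _ h => interior_subset (ht3 i j h)
    -- By convexity the `i`-th part is a multiple of some `z i ∈ A i` with factor at least `a i`,
    -- hence lies in `V i`.
    have h1 : ∑ i, ∑ j, t i j • y j ∈ U := by
      refine hVU (a := fun i => ∑ j, t i j • y j) fun i _ => ?_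
      change ∑ j, t i j • y j ∈ V i
      rw [hzt]
      exact haV' i _ (ht1 i) _ (hAV i (hz i))
    -- The unassigned mass is split off, to be absorbed by `add_mem`.
    have h2 : ∑ j, s j • y j =
        ∑ i, ∑ j, t i j • y j + ∑ j, (s j - ∑ i, t i j) • y j := by
      rw [Finset.sum_comm, ← Finset.sum_add_distrib]
      refine Finset.sum_congr rfl fun j _ => ?_
      rw [← Finset.sum_smul, ← add_smul, add_tsub_cancel_of_le (ht2 j)]
    rw [h2]
    exact hC.add_mem hU h1 _

/-- The evaluation of formal linear combinations in a weakly locally convex topological cone is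
continuous with respect to the weak topology. -/
theorem exists_nhds_sum_smul_mem (hC : IsTopologicalCone C) (hW : IsWeaklyLocallyConvex C)
    {ι : Type*} [Fintype ι] (r : ι → ℝ≥0) (x : ι → C) {U : Set C} (hU : IsOpen U)
    (hx : ∑ i, r i • x i ∈ U) :
    ∃ N : Set (ContValuation C), IsOpen N ∧ ∑ i, r i • ContValuation.dirac (x i) ∈ N ∧
      ∀ (n : ℕ) (s : Fin n → ℝ≥0) (y : Fin n → C),
        ∑ j, s j • ContValuation.dirac (y j) ∈ N → ∑ j, s j • y j ∈ U := by
  classical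
  -- Zero coefficients are discarded, since there is no scalar strictly below them; this is done
  -- both in `C` and among valuations.
  have key : ∀ {M : Type _} [AddCommMonoid M] [Module ℝ≥0 M] (f : ι → M),
      ∑ i, r i • f i = ∑ i : {i // i ∈ Finset.univ.filter fun i => r i ≠ 0}, r i • f i := by
    intro M _ _ f
    rw [Finset.sum_coe_sort (Finset.univ.filter fun i => r i ≠ 0) fun i => r i • f i,
      Finset.sum_filter_of_ne]
    rintro i - h h0
    exact h (by rw [h0, zero_smul])
  rw [key] at hx
  rw [key]
  exact exists_nhds_sum_smul_mem_of_pos hC hW _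
    (fun i => pos_iff_ne_zero.2 (Finset.mem_filter (p := fun i => r i ≠ 0).1 i.2).2) _ hU hx

/-- Well-definedness comes from topology: equal valuations share their neighbourhoods `N`, so the
two sums lie in the same open sets and coincide by `T₀`. -/
theorem sum_smul_eq_of_sum_dirac_eq (hC : IsTopologicalCone C) (hW : IsWeaklyLocallyConvex C)
    {m n : ℕ} {r : Fin m → ℝ≥0} {x : Fin m → C} {s : Fin n → ℝ≥0} {y : Fin n → C}
    (h : ∑ i, r i • ContValuation.dirac (x i) = ∑ j, s j • ContValuation.dirac (y j)) :
    ∑ i, r i • x i = ∑ j, s j • y j := by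
  have := hC.t0
  refine (inseparable_iff_forall_isOpen.2 fun U hU => ⟨fun hx => ?_, fun hy => ?_⟩).eq
  · obtain ⟨N, -, hN, hNU⟩ := exists_nhds_sum_smul_mem hC hW r x hU hx
    exact hNU n s y (h ▸ hN)
  · obtain ⟨N, -, hN, hNU⟩ := exists_nhds_sum_smul_mem hC hW s y hU hy
    exact hNU m r x (h ▸ hN)

theorem exists_continuous_eval_simple (hC : IsTopologicalCone C) (hW : IsWeaklyLocallyConvex C) :
    ∃ β : C({μ : ContValuation C // μ.IsSimple}, C),
      ∀ (n : ℕ) (r : Fin n → ℝ≥0) (x : Fin n → C),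
        β ⟨∑ i, r i • ContValuation.dirac (x i), n, r, x, rfl⟩ = ∑ i, r i • x i := by
  choose n r x hμ using fun μ : {μ : ContValuation C // μ.IsSimple} => μ.2
  have spec : ∀ (m : ℕ) (s : Fin m → ℝ≥0) (y : Fin m → C)
      (μ : {μ : ContValuation C // μ.IsSimple}),
      μ.1 = ∑ j, s j • ContValuation.dirac (y j) →
      ∑ i, r μ i • x μ i = ∑ j, s j • y j := fun m s y μ e =>
    sum_smul_eq_of_sum_dirac_eq hC hW ((hμ μ).symm.trans e)
  refine ⟨⟨fun μ => ∑ i, r μ i • x μ i, continuous_def.2 fun U hU => ?_⟩,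
    fun m s y => spec m s y _ rfl⟩
  refine isOpen_iff_mem_nhds.2 fun μ hU' => ?_
  obtain ⟨N, hNo, hN, hNU⟩ := exists_nhds_sum_smul_mem hC hW (r μ) (x μ) hU hU'
  rw [← hμ μ] at hN
  filter_upwards [(hNo.preimage continuous_subtype_val).mem_nhds hN] with ν hν
  refine hNU _ _ _ ?_
  rw [← hμ ν]
  exact hν

end TopologicalCone

/-! ### Barycentre maps -/

namespace KCategory

variable (𝒦 : KCategory.{u})

theorem isTopologicalCone_VK (X : Type u) [TopologicalSpace X] : IsTopologicalCone (𝒦.VK X) :=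
  ContValuation.isTopologicalCone.comp_induced (𝒦.VK X).subtype IsEmbedding.subtypeVal

instance (X : Type u) [TopologicalSpace X] : ContinuousAdd (𝒦.VK X) :=
  ⟨(𝒦.isTopologicalCone_VK X).continuous_add⟩

theorem coe_sum_δ {X : Type u} [TopologicalSpace X] {n : ℕ} (r : Fin n → ℝ≥0) (x : Fin n → X) :
    ((∑ i, r i • 𝒦.δ (x i) : 𝒦.VK X) : ContValuation X) =
      ∑ i, r i • ContValuation.dirac (x i) := by
  simp [δ]

section Barycentre

variable {C : Type u} [AddCommMonoid C] [Module ℝ≥0 C] [TopologicalSpace C]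

/-- Linearity and the barycentre identity are clear at simple valuations and propagate by Skula
density. -/
theorem isBarycentreMap_of_simple (hC : IsTopologicalCone C) (ρ : C(𝒦.VK C, C))
    (h : ∀ (n : ℕ) (r : Fin n → ℝ≥0) (x : Fin n → C),
      ρ (∑ i, r i • 𝒦.δ (x i)) = ∑ i, r i • x i) : 𝒦.IsBarycentreMap ρ := by
  have := hC.t0
  have : ContinuousAdd C := ⟨hC.continuous_add⟩
  refine ⟨⟨fun μ ν => ?_, fun a μ => ?_⟩, fun μ Λ hΛ hlin => ?_, h⟩
  -- Density is applied in one variable at a time.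
  · refine 𝒦.VK_hom_ext (φ := fun μ => ρ (μ + ν)) (ψ := fun μ => ρ μ + ρ ν) (by fun_prop)
      (by fun_prop) (fun m r x => ?_) μ
    refine 𝒦.VK_hom_ext (φ := fun ν => ρ (_ + ν)) (ψ := fun ν => ρ _ + ρ ν) (by fun_prop)
      (by fun_prop) (fun n s y => ?_) ν
    have e : ∑ i, r i • 𝒦.δ (x i) + ∑ j, s j • 𝒦.δ (y j) =
        ∑ i, Fin.append r s i • 𝒦.δ (Fin.append x y i) := by
      simp [Fin.sum_univ_add]
    rw [e, h, h, h]
    simp [Fin.sum_univ_add]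
  · refine 𝒦.VK_hom_ext (φ := fun μ => ρ (a • μ)) (ψ := fun μ => a • ρ μ)
      (ρ.continuous.comp ((𝒦.isTopologicalCone_VK C).continuous_const_smul a))
      ((hC.continuous_const_smul a).comp ρ.continuous) (fun m r x => ?_) μ
    have e : a • ∑ i, r i • 𝒦.δ (x i) = ∑ i, (a * r i) • 𝒦.δ (x i) := by
      simp [Finset.smul_sum, mul_smul]
    rw [e, h, h]
    simp [Finset.smul_sum, mul_smul]
  · refine 𝒦.VK_lsc_ext (φ := fun μ => Λ (ρ μ)) (ψ := fun μ => μ.1.integral Λ hΛ)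
      (ContValuation.lsc_comp ρ.continuous hΛ)
      (ContValuation.lsc_comp continuous_subtype_val (ContValuation.lsc_integral hΛ))
      (fun m r x => ?_) μ
    rw [h, coe_sum_δ, ContValuation.integral_sum_dirac]
    change hlin.mk' Λ _ = _
    simp

/-- A weakly locally convex `𝒦`-cone has a barycentre map. -/
theorem exists_isBarycentreMap (hC : IsTopologicalCone C) (hW : IsWeaklyLocallyConvex C)
    (hK : have := hC.t0; 𝒦.IsKSpace C) : ∃ ρ : C(𝒦.VK C, C), 𝒦.IsBarycentreMap ρ := by
  have := hC.t0
  obtain ⟨β, hβ⟩ := exists_continuous_eval_simple hC hW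
  obtain ⟨ρ, hρ, -⟩ := (𝒦.isKCompletion_simpleIncl (X := C)).2.2 C hK β β.continuous
  refine ⟨ρ, 𝒦.isBarycentreMap_of_simple hC ρ fun n r x => ?_⟩
  rw [← hβ, ← hρ]
  congr 1
  exact Subtype.ext (𝒦.coe_sum_δ r x)

theorem IsBarycentreMap.unique {𝒦 : KCategory.{u}} [T0Space C] {ρ : C(𝒦.VK C, C)}
    (hρ : 𝒦.IsBarycentreMap ρ) (ρ' : C(𝒦.VK C, C)) (h : ∀ (n : ℕ) (r : Fin n → ℝ≥0) (x : Fin n → C),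
      ρ' (∑ i, r i • 𝒦.δ (x i)) = ∑ i, r i • x i) : ρ' = ρ :=
  ContinuousMap.ext (𝒦.VK_hom_ext ρ'.continuous ρ.continuous
    fun n r x => (h n r x).trans (hρ.simple n r x).symm)

theorem IsBarycentreMap.apply_δ {𝒦 : KCategory.{u}} {ρ : C(𝒦.VK C, C)}
    (hρ : 𝒦.IsBarycentreMap ρ) (x : C) : ρ (𝒦.δ x) = x := by
  simpa using hρ.simple 1 (fun _ => 1) fun _ => x

theorem mapVK_sum {X Y : Type u} [TopologicalSpace X] [TopologicalSpace Y] (f : C(X, Y)) {n : ℕ}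
    (r : Fin n → ℝ≥0) (x : Fin n → X) :
    𝒦.mapVK f (∑ i, r i • 𝒦.δ (x i)) = ∑ i, r i • 𝒦.δ (f (x i)) := by
  refine Subtype.ext ?_
  rw [coe_sum_δ]
  change ContValuation.map f _ = _
  rw [coe_sum_δ, ContValuation.map_sum]

theorem mult_sum {X : Type u} [TopologicalSpace X] {n : ℕ} (r : Fin n → ℝ≥0)
    (μ : Fin n → 𝒦.VK X) : 𝒦.mult (∑ i, r i • 𝒦.δ (μ i)) = ∑ i, r i • μ i := by
  refine Subtype.ext ?_
  change ContValuation.bind 𝒦.incl _ = _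
  rw [coe_sum_δ, ContValuation.bind_sum]
  simp [incl]

/-- For simple `ϖ = ∑ rᵢ δ_{μᵢ}`, with arbitrary `μᵢ`, the claim is linearity of `ρ`. -/
theorem IsBarycentreMap.mult_eq {𝒦 : KCategory.{u}} [T0Space C] {ρ : C(𝒦.VK C, C)}
    (hρ : 𝒦.IsBarycentreMap ρ) (ϖ : 𝒦.VK (𝒦.VK C)) : ρ (𝒦.mult ϖ) = ρ (𝒦.mapVK ρ ϖ) := by
  refine 𝒦.VK_hom_ext (ρ.continuous.comp 𝒦.mult.continuous)
    (ρ.continuous.comp (𝒦.mapVK ρ).continuous) (fun n r μ => ?_) ϖ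
  change ρ (𝒦.mult _) = ρ (𝒦.mapVK ρ _)
  rw [mult_sum, mapVK_sum, hρ.simple]
  change hρ.linear.mk' ρ _ = _
  simp

theorem IsBarycentreMap.comp_eq {𝒦 : KCategory.{u}} {D : Type u} [AddCommMonoid D] [Module ℝ≥0 D]
    [TopologicalSpace D] [T0Space D] {ρ : C(𝒦.VK C, C)} (hρ : 𝒦.IsBarycentreMap ρ)
    {σ : C(𝒦.VK D, D)} (hσ : 𝒦.IsBarycentreMap σ) (f : C(C, D)) (hf : IsLinearMap ℝ≥0 f)
    (μ : 𝒦.VK C) : σ (𝒦.mapVK f μ) = f (ρ μ) := by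
  refine 𝒦.VK_hom_ext (σ.continuous.comp (𝒦.mapVK f).continuous)
    (f.continuous.comp ρ.continuous) (fun n r x => ?_) μ
  change σ (𝒦.mapVK f _) = f (ρ _)
  rw [mapVK_sum, hρ.simple, hσ.simple]
  change _ = hf.mk' f _
  simp

end Barycentre

/-- The laws of an algebra of the monad `V_𝒦`. -/
structure IsAlgebra {X : Type u} [TopologicalSpace X] (ρ : C(𝒦.VK X, X)) : Prop where
  unit : ∀ x, ρ (𝒦.δ x) = x
  assoc : ∀ ϖ, ρ (𝒦.mult ϖ) = ρ (𝒦.mapVK ρ ϖ)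

/-! ### From algebras to cones -/

namespace IsAlgebra

variable {𝒦} {X : Type u} [TopologicalSpace X] {ρ : C(𝒦.VK X, X)}

/-- Associativity at `δ_μ + δ_ν`. Once addition on `X` is defined through `ρ`, this is additivity of
`ρ`. -/
theorem map_add (hρ : 𝒦.IsAlgebra ρ) (μ ν : 𝒦.VK X) :
    ρ (μ + ν) = ρ (𝒦.δ (ρ μ) + 𝒦.δ (ρ ν)) := by
  have h := hρ.assoc (∑ i, (fun _ => 1 : Fin 2 → ℝ≥0) i • 𝒦.δ (![μ, ν] i))
  rw [mult_sum, mapVK_sum] at h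
  simpa using h

theorem map_smul (hρ : 𝒦.IsAlgebra ρ) (r : ℝ≥0) (μ : 𝒦.VK X) :
    ρ (r • μ) = ρ (r • 𝒦.δ (ρ μ)) := by
  have h := hρ.assoc (∑ i, (fun _ => r : Fin 1 → ℝ≥0) i • 𝒦.δ ((fun _ => μ) i))
  rw [mult_sum, mapVK_sum] at h
  simpa using h

theorem add_left (hρ : 𝒦.IsAlgebra ρ) (μ : 𝒦.VK X) (x : X) :
    ρ (𝒦.δ (ρ μ) + 𝒦.δ x) = ρ (μ + 𝒦.δ x) := by
  rw [hρ.map_add μ, hρ.unit]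

theorem add_right (hρ : 𝒦.IsAlgebra ρ) (x : X) (μ : 𝒦.VK X) :
    ρ (𝒦.δ x + 𝒦.δ (ρ μ)) = ρ (𝒦.δ x + μ) := by
  rw [hρ.map_add _ μ, hρ.unit]

/-- The addition `x + y = ρ(δ_x + δ_y)` of an algebra. -/
@[reducible] noncomputable def addCommMonoid (hρ : 𝒦.IsAlgebra ρ) : AddCommMonoid X where
  add x y := ρ (𝒦.δ x + 𝒦.δ y)
  add_assoc x y z := by
    change ρ (𝒦.δ (ρ _) + 𝒦.δ z) = ρ (𝒦.δ x + 𝒦.δ (ρ _))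
    rw [hρ.add_left, hρ.add_right, add_assoc]
  zero := ρ 0
  zero_add x := by
    change ρ (𝒦.δ (ρ 0) + 𝒦.δ x) = x
    rw [hρ.add_left, zero_add, hρ.unit]
  add_zero x := by
    change ρ (𝒦.δ x + 𝒦.δ (ρ 0)) = x
    rw [hρ.add_right, add_zero, hρ.unit]
  add_comm x y := by
    change ρ (𝒦.δ x + 𝒦.δ y) = ρ (𝒦.δ y + 𝒦.δ x)
    rw [add_comm]
  nsmul := @nsmulRec X ⟨ρ 0⟩ ⟨fun x y => ρ (𝒦.δ x + 𝒦.δ y)⟩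
  nsmul_zero _ := rfl
  nsmul_succ _ _ := rfl

/-- The scalar multiplication `r x = ρ(r δ_x)` of an algebra. -/
@[reducible] noncomputable def module (hρ : 𝒦.IsAlgebra ρ) :
    letI := hρ.addCommMonoid
    Module ℝ≥0 X :=
  letI := hρ.addCommMonoid
  { smul := fun r x => ρ (r • 𝒦.δ x)
    one_smul := fun x => by
      change ρ ((1 : ℝ≥0) • 𝒦.δ x) = x
      rw [one_smul, hρ.unit]
    mul_smul := fun r s x => by
      change ρ ((r * s) • 𝒦.δ x) = ρ (r • 𝒦.δ (ρ (s • 𝒦.δ x)))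
      rw [← hρ.map_smul, mul_smul]
    smul_zero := fun r => by
      change ρ (r • 𝒦.δ (ρ 0)) = ρ 0
      rw [← hρ.map_smul, smul_zero]
    smul_add := fun r x y => by
      change ρ (r • 𝒦.δ (ρ (𝒦.δ x + 𝒦.δ y))) =
        ρ (𝒦.δ (ρ (r • 𝒦.δ x)) + 𝒦.δ (ρ (r • 𝒦.δ y)))
      rw [← hρ.map_smul, ← hρ.map_add, smul_add]
    add_smul := fun r s x => by
      change ρ ((r + s) • 𝒦.δ x) = ρ (𝒦.δ (ρ (r • 𝒦.δ x)) + 𝒦.δ (ρ (s • 𝒦.δ x)))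
      rw [← hρ.map_add, add_smul]
    zero_smul := fun x => by
      change ρ ((0 : ℝ≥0) • 𝒦.δ x) = ρ 0
      rw [zero_smul] }

theorem isLinearMap (hρ : 𝒦.IsAlgebra ρ) :
    letI := hρ.addCommMonoid
    letI := hρ.module
    IsLinearMap ℝ≥0 ρ :=
  letI := hρ.addCommMonoid
  letI := hρ.module
  ⟨hρ.map_add, hρ.map_smul⟩

theorem isTopologicalCone [T0Space X] (hρ : 𝒦.IsAlgebra ρ) :
    letI := hρ.addCommMonoid
    letI := hρ.module
    IsTopologicalCone X :=
  letI := hρ.addCommMonoid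
  letI := hρ.module
  { t0 := inferInstance
    continuous_add := ρ.continuous.comp ((𝒦.isTopologicalCone_VK X).continuous_add.comp
      (𝒦.unit.continuous.prodMap 𝒦.unit.continuous))
    continuous_smul := ρ.continuous.comp ((𝒦.isTopologicalCone_VK X).continuous_smul.comp
      (continuous_id.prodMap 𝒦.unit.continuous)) }

/-- The image under `ρ` of a convex weakly open set is convex by linearity. It need not be open, but
it contains the open set of those `y` whose Dirac mass lies in it, because `ρ (δ y) = y`. -/
theorem isWeaklyLocallyConvex (hρ : 𝒦.IsAlgebra ρ) :
    letI := hρ.addCommMonoid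
    letI := hρ.module
    IsWeaklyLocallyConvex X := by
  let := hρ.addCommMonoid
  let := hρ.module
  intro x U hU hx
  obtain ⟨O, hO, e⟩ := isOpen_induced_iff.1 (hU.preimage ρ.continuous)
  have hxO : (𝒦.δ x : ContValuation X) ∈ O := by
    refine (Set.ext_iff.1 e (𝒦.δ x)).2 ?_
    rwa [mem_preimage, hρ.unit]
  obtain ⟨W, hW, hxW, hWO, hWc⟩ := ContValuation.exists_convex_open_subset hO hxO
  refine ⟨ρ '' (((↑) : 𝒦.VK X → ContValuation X) ⁻¹' W), ?_, ?_, ?_⟩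
  · filter_upwards [(hW.preimage (continuous_subtype_val.comp 𝒦.unit.continuous)).mem_nhds hxW]
      with y hy
    exact ⟨𝒦.δ y, hy, hρ.unit y⟩
  · rintro _ ⟨μ, hμ, rfl⟩
    exact (Set.ext_iff.1 e μ).1 (hWO hμ)
  · exact (hWc.is_linear_preimage (𝒦.VK X).subtype.isLinear).is_linear_image hρ.isLinearMap

/-- The weakly locally convex `𝒦`-cone of an algebra. -/
noncomputable def coneStr [T0Space X] (hρ : 𝒦.IsAlgebra ρ) : 𝒦.ConeStr X where
  addCommMonoid := hρ.addCommMonoid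
  module := hρ.module
  isTopologicalCone := hρ.isTopologicalCone
  isWeaklyLocallyConvex := hρ.isWeaklyLocallyConvex
  isKSpace := 𝒦.isKSpace_of_retract 𝒦.isKSpace_VK 𝒦.unit ρ hρ.unit

theorem isBarycentreMap [T0Space X] (hρ : 𝒦.IsAlgebra ρ) :
    letI := hρ.addCommMonoid
    letI := hρ.module
    𝒦.IsBarycentreMap ρ := by
  let := hρ.addCommMonoid
  let := hρ.module
  refine 𝒦.isBarycentreMap_of_simple hρ.isTopologicalCone ρ fun n r x => ?_
  change hρ.isLinearMap.mk' ρ _ = _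
  simp only [_root_.map_sum, _root_.map_smul]
  exact Finset.sum_congr rfl fun i _ => congrArg _ (hρ.unit _)

end IsAlgebra

/-! ### The functors and the isomorphism of categories -/

theorem ConeStr.ext {𝒦 : KCategory.{u}} {X : Type u} [TopologicalSpace X] [T0Space X]
    {s t : 𝒦.ConeStr X} (hadd : ∀ x y : X, s.addCommMonoid.add x y = t.addCommMonoid.add x y)
    (hsmul : ∀ (r : ℝ≥0) (x : X), s.module.smul r x = t.module.smul r x) : s = t := by
  obtain ⟨a, m, _, _, _⟩ := s
  obtain ⟨a', m', _, _, _⟩ := t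
  obtain rfl : a = a' := by
    refine AddCommMonoid.ext (funext fun x => funext fun y => hadd x y)
  obtain rfl : m = m' := by
    refine Module.ext' _ _ fun r x => hsmul r x
  rfl

variable {𝒦} in
theorem isAlgebra_structureMap (A : 𝒦.monad.Algebra) : 𝒦.IsAlgebra (𝒦.structureMap A) where
  unit x := congrArg (fun f : A.A ⟶ A.A => Top0.toMap f x) A.unit
  assoc ϖ := congrArg (fun f : 𝒦.monad.obj (𝒦.monad.obj A.A) ⟶ A.A => Top0.toMap f ϖ) A.assoc

variable {𝒦} in
theorem structureMap_naturality {A B : 𝒦.monad.Algebra} (f : A ⟶ B) (μ : 𝒦.VK A.A) :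
    𝒦.structureMap B (𝒦.mapVK (Top0.toMap f.f) μ) = Top0.toMap f.f (𝒦.structureMap A μ) :=
  congrArg (fun g : 𝒦.monad.obj A.A ⟶ B.A => Top0.toMap g μ) f.h

variable {𝒦} in
/-- The weakly locally convex `𝒦`-cone of an algebra of the monad. -/
noncomputable def coneOfAlgebraObj (A : 𝒦.monad.Algebra) : 𝒦.Cone :=
  ⟨A.A, (isAlgebra_structureMap A).coneStr⟩

variable {𝒦} in
theorem isLinearMap_of_algebraHom {A B : 𝒦.monad.Algebra} (f : A ⟶ B) :
    IsLinearMap ℝ≥0 (M := (coneOfAlgebraObj A).space) (M₂ := (coneOfAlgebraObj B).space)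
      (Top0.toMap f.f) :=
  ⟨fun x y => (structureMap_naturality f (𝒦.δ x + 𝒦.δ y)).symm,
    fun r x => (structureMap_naturality f (r • 𝒦.δ x)).symm⟩

/-- The functor from algebras to cones. -/
noncomputable def coneOfAlgebra : 𝒦.monad.Algebra ⥤ 𝒦.Cone where
  obj A := coneOfAlgebraObj A
  map f := ⟨f.f, isLinearMap_of_algebraHom f⟩
  map_id _ := rfl
  map_comp _ _ := rfl

variable {𝒦} in
theorem Cone.exists_isBarycentreMap (C : 𝒦.Cone) :
    ∃ ρ : C(𝒦.VK C.space, C.space), 𝒦.IsBarycentreMap ρ :=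
  𝒦.exists_isBarycentreMap C.str.isTopologicalCone C.str.isWeaklyLocallyConvex C.str.isKSpace

variable {𝒦} in
/-- The barycentre map of a cone. -/
noncomputable def Cone.barycentreMap (C : 𝒦.Cone) : C(𝒦.VK C.space, C.space) :=
  C.exists_isBarycentreMap.choose

variable {𝒦} in
theorem Cone.isBarycentreMap (C : 𝒦.Cone) : 𝒦.IsBarycentreMap C.barycentreMap :=
  C.exists_isBarycentreMap.choose_spec

/-- The structure morphism of a cone. -/
noncomputable def Cone.structureHom {𝒦 : KCategory.{u}} (C : 𝒦.Cone) :
    𝒦.monad.obj C.space ⟶ C.space :=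
  Top0.ofHom (X := Top0.of (𝒦.VK C.space)) C.barycentreMap

theorem top0_hom_ext {X Y : Top0.{u}} {f g : X ⟶ Y} (h : ∀ x, Top0.toMap f x = Top0.toMap g x) :
    f = g :=
  ObjectProperty.hom_ext _ (TopCat.hom_ext (ContinuousMap.ext h))

theorem Cone.structureHom_unit {𝒦 : KCategory.{u}} (C : 𝒦.Cone) :
    𝒦.monad.η.app C.space ≫ C.structureHom = 𝟙 C.space :=
  top0_hom_ext C.isBarycentreMap.apply_δ

theorem Cone.structureHom_assoc {𝒦 : KCategory.{u}} (C : 𝒦.Cone) :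
    𝒦.monad.μ.app C.space ≫ C.structureHom = 𝒦.monad.map C.structureHom ≫ C.structureHom :=
  top0_hom_ext C.isBarycentreMap.mult_eq

/-- The functor from cones to algebras. -/
noncomputable def algebraOfCone : 𝒦.Cone ⥤ 𝒦.monad.Algebra where
  obj C := ⟨C.space, C.structureHom, C.structureHom_unit, C.structureHom_assoc⟩
  map {C D} f :=
    { f := f.hom
      h := top0_hom_ext
        (C.isBarycentreMap.comp_eq D.isBarycentreMap (Top0.toMap f.hom) f.linear) }
  map_id _ := rfl
  map_comp _ _ := rfl

/-- The structure map of `A` is itself a barycentre map for the cone that it defines, and barycentre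
maps are unique. -/
theorem algebraOfCone_coneOfAlgebra_obj (A : 𝒦.monad.Algebra) :
    (𝒦.algebraOfCone.obj (𝒦.coneOfAlgebra.obj A)) = A := by
  have h : (𝒦.coneOfAlgebra.obj A).structureHom = A.a := by
    let := (isAlgebra_structureMap A).addCommMonoid
    let := (isAlgebra_structureMap A).module
    have := (𝒦.coneOfAlgebra.obj A).isBarycentreMap.unique (𝒦.structureMap A)
      (isAlgebra_structureMap A).isBarycentreMap.simple
    exact top0_hom_ext fun μ => (DFunLike.congr_fun this μ).symm
  obtain ⟨X, a, _, _⟩ := A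
  simp only [algebraOfCone]
  congr 1

/-- The recovered operations are the original ones, because the barycentre map is linear and sends
`δ x` to `x`. -/
theorem coneOfAlgebra_algebraOfCone_obj (C : 𝒦.Cone) :
    (𝒦.coneOfAlgebra.obj (𝒦.algebraOfCone.obj C)) = C := by
  have h : (isAlgebra_structureMap (𝒦.algebraOfCone.obj C)).coneStr = C.str := by
    refine ConeStr.ext (fun (x y : C.space) => ?_) (fun r (x : C.space) => ?_)
    · change C.barycentreMap (𝒦.δ x + 𝒦.δ y) = x + y
      rw [C.isBarycentreMap.linear.map_add, C.isBarycentreMap.apply_δ,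
        C.isBarycentreMap.apply_δ]
    · change C.barycentreMap (r • 𝒦.δ x) = r • x
      rw [C.isBarycentreMap.linear.map_smul, C.isBarycentreMap.apply_δ]
  obtain ⟨X, s⟩ := C
  exact congrArg (Cone.mk X) h

/-- Removes the transports along object equalities: both constructions keep underlying maps, so
after the forgetful functor the equality is definitional. -/
theorem functor_ext_of_faithful {𝒜 ℬ 𝒯 : Type*} [Category* 𝒜] [Category* ℬ] [Category* 𝒯]
    {F G : 𝒜 ⥤ ℬ} (U : ℬ ⥤ 𝒯) [U.Faithful] (h : ∀ X, F.obj X = G.obj X)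
    (hU : F ⋙ U = G ⋙ U) : F = G := by
  refine CategoryTheory.Functor.ext h fun X Y f => U.map_injective ?_
  rw [U.map_comp, U.map_comp, eqToHom_map, eqToHom_map]
  exact Functor.congr_hom hU f

instance : (Cone.forget 𝒦).Faithful := ⟨fun h => Cone.Hom.ext h⟩

theorem coneOfAlgebra_comp_algebraOfCone : 𝒦.coneOfAlgebra ⋙ 𝒦.algebraOfCone = 𝟭 _ :=
  functor_ext_of_faithful 𝒦.monad.forget 𝒦.algebraOfCone_coneOfAlgebra_obj rfl

theorem algebraOfCone_comp_coneOfAlgebra : 𝒦.algebraOfCone ⋙ 𝒦.coneOfAlgebra = 𝟭 _ :=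
  functor_ext_of_faithful (Cone.forget 𝒦) 𝒦.coneOfAlgebra_algebraOfCone_obj rfl

end KCategory

end ValuationCones

theorem mainTheorem3 (𝒦 : ValuationCones.KCategory.{u}) :
    -- the space `V_𝒦 X` is a `𝒦`-completion of the space of simple valuations on `X`
    (∀ X : ValuationCones.Top0.{u},
      𝒦.IsKCompletion (𝒦.simpleIncl : _ → 𝒦.VK X)) ∧
    -- the two categories are isomorphic
    ∃ (F : 𝒦.monad.Algebra ⥤ 𝒦.Cone) (G : 𝒦.Cone ⥤ 𝒦.monad.Algebra),
      F ⋙ G = 𝟭 _ ∧ G ⋙ F = 𝟭 _ ∧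
      -- underlying spaces and underlying maps are preserved
      F ⋙ ValuationCones.KCategory.Cone.forget 𝒦 = Monad.forget 𝒦.monad ∧
      G ⋙ Monad.forget 𝒦.monad = ValuationCones.KCategory.Cone.forget 𝒦 ∧
      -- the cone structure of an algebra
      (∀ A : 𝒦.monad.Algebra, ∃ s : 𝒦.ConeStr A.A,
        F.obj A = ⟨A.A, s⟩ ∧
        letI := s.addCommMonoid
        letI := s.module
        (∀ x y : A.A, x + y = 𝒦.structureMap A (𝒦.δ x + 𝒦.δ y)) ∧
        (∀ (r : ℝ≥0) (x : A.A), r • x = 𝒦.structureMap A (r • 𝒦.δ x)) ∧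
        𝒦.IsBarycentreMap (𝒦.structureMap A)) ∧
      -- the algebra structure of a cone
      (∀ C : 𝒦.Cone, ∃ (ρ : 𝒦.monad.obj C.space ⟶ C.space)
          (h₁ : 𝒦.monad.η.app C.space ≫ ρ = 𝟙 C.space)
          (h₂ : 𝒦.monad.μ.app C.space ≫ ρ = 𝒦.monad.map ρ ≫ ρ),
        G.obj C = ⟨C.space, ρ, h₁, h₂⟩ ∧
        𝒦.IsBarycentreMap (C := C.space) (ValuationCones.Top0.toMap ρ) ∧
        ∀ ρ' : C(𝒦.VK C.space, C.space),
          (∀ (n : ℕ) (r : Fin n → ℝ≥0) (x : Fin n → C.space),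
            ρ' (∑ i, r i • 𝒦.δ (x i)) = ∑ i, r i • x i) →
          ρ' = ValuationCones.Top0.toMap ρ) := by
  refine ⟨fun X => 𝒦.isKCompletion_simpleIncl, 𝒦.coneOfAlgebra, 𝒦.algebraOfCone,
    𝒦.coneOfAlgebra_comp_algebraOfCone, 𝒦.algebraOfCone_comp_coneOfAlgebra, rfl, rfl,
    fun A => ?_, fun C => ?_⟩
  · have h := ValuationCones.KCategory.isAlgebra_structureMap A
    exact ⟨h.coneStr, rfl, fun _ _ => rfl, fun _ _ => rfl, h.isBarycentreMap⟩
  · exact ⟨C.structureHom, C.structureHom_unit, C.structureHom_assoc, rfl, C.isBarycentreMap,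
      C.isBarycentreMap.unique⟩
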